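/- Let $\mathbb{K}$ be a field, let $R=\mathbb{K}\langle x,y\rangle/(xy-1)$, let $I=\langle 1-yx\rangle$ be the two-sided ideal of $R$ generated by $1-yx$, and let $S_1=R(1-yx)$, a left ideal of $R$. All modules are left modules and $\operatorname{Ext}^1$, $\operatorname{Hom}$ without a subscript are taken over $R$. Since $R/I\cong\mathbb{K}[x,x^{-1}]$ (with $y\mapsto x^{-1}$), every $R$-module $V$ with $IV=0$ is regarded as a $\mathbb{K}[x,x^{-1}]$-module on which $x^{-1}$ acts as $y$; this applies to all finite-dimensional modules, to $M/IM$ for every $R$-module $M$, and to $\operatorname{lf}(M)$, the sum of all finite-dimensional submodules of $M$. Write $\ell$ for the length of an $R$-module and, for $M$ of finite length, let $d(M)$ be the largest non-negative integer $d$ such that $M=P\oplus M'$ for some submodules $P\cong S_1^{\oplus d}$ and $M'$ of $M$. Suppose $M$ and $N$ are finite-length $R$-modules and $F$ is a finite-dimensional $R$-module. Then all the dimensions and lengths below are finite, the maximum defining $d(M)$ exists, and \begin{align*} (i)\quad \dim_{\mathbb{K}}\operatorname{Ext}^1(F,N) ={}& \dim_{\mathbb{K}}\operatorname{Ext}^1_{\mathbb{K}[x,x^{-1}]}(F,N/IN)+\ell(IN)\dim_{\mathbb{K}}F\\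 &+\dim_{\mathbb{K}}\operatorname{Hom}_{\mathbb{K}[x,x^{-1}]}(F,\operatorname{lf}(N))-\dim_{\mathbb{K}}\operatorname{Hom}_{\mathbb{K}[x,x^{-1}]}(F,N/IN);\\ (ii)\quad \dim_{\mathbb{K}}\operatorname{Ext}^1(M,N) ={}& \dim_{\mathbb{K}}\operatorname{Ext}^1(M/IM,N)+\dim_{\mathbb{K}}\operatorname{Hom}(M,N)\\ &-\dim_{\mathbb{K}}\operatorname{Hom}_{\mathbb{K}[x,x^{-1}]}(M/IM,\operatorname{lf}(N))-\ell(IM)\,\ell(IN);\\ (iii)\quad \dim_{\mathbb{K}}\operatorname{Ext}^1(M,F) ={}& \dim_{\mathbb{K}}\operatorname{Ext}^1_{\mathbb{K}[x,x^{-1}]}(M/IM,F);\\ (iv)\quad \dim_{\mathbb{K}}\operatorname{Ext}^1(M,N) ={}& \dim_{\mathbb{K}}\operatorname{Ext}^1_{\mathbb{K}[x,x^{-1}]}(M/IM,N/IN)+\dim_{\mathbb{K}}\operatorname{Ext}^1(M,IN)\\ &+\dim_{\mathbb{K}}\operatorname{Hom}(M,N)-\dim_{\mathbb{K}}\operatorname{Hom}_{\mathbb{K}[x,x^{-1}]}(M/IM,N/IN)-d(M)\,\ell(IN).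 \end{align*} -/

import Mathlib

open CategoryTheory
open scoped LaurentPolynomial

universe u

noncomputable section

/-- The defining relation `x * y = 1` on the free algebra on `x = ι 0` and `y = ι 1`. -/
inductive ToeplitzRel (K : Type u) [Field K] :
    FreeAlgebra K (Fin 2) → FreeAlgebra K (Fin 2) → Prop
  | xy : ToeplitzRel K (FreeAlgebra.ι K 0 * FreeAlgebra.ι K 1) 1

/-- The algebraic Toeplitz (Jacobson) algebra `R = K⟨x, y⟩ / (x y - 1)`. -/
def ToeplitzAlgebra (K : Type u) [Field K] : Type u := RingQuot (ToeplitzRel K)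

namespace ToeplitzAlgebra

instance instRing (K : Type u) [Field K] : Ring (ToeplitzAlgebra K) :=
  inferInstanceAs (Ring (RingQuot (ToeplitzRel K)))

instance instAlgebra (K : Type u) [Field K] : Algebra K (ToeplitzAlgebra K) :=
  inferInstanceAs (Algebra K (RingQuot (ToeplitzRel K)))

variable (K : Type u) [Field K]

/-- The generator `x`. -/
def x : ToeplitzAlgebra K := RingQuot.mkAlgHom K (ToeplitzRel K) (FreeAlgebra.ι K 0)

/-- The generator `y`. -/
def y : ToeplitzAlgebra K := RingQuot.mkAlgHom K (ToeplitzRel K) (FreeAlgebra.ι K 1)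

theorem x_mul_y : x K * y K = 1 := by
  have h := RingQuot.mkAlgHom_rel K (ToeplitzRel.xy (K := K))
  rw [map_mul, map_one] at h
  exact h

/-- The two-sided ideal `I = ⟨1 - y x⟩` of `R`. -/
def I : TwoSidedIdeal (ToeplitzAlgebra K) := TwoSidedIdeal.span {1 - y K * x K}

/-- The simple left module `S₁ = R f₁`, the left ideal generated by the idempotent
`f₁ = 1 - y x`. -/
def S : Submodule (ToeplitzAlgebra K) (ToeplitzAlgebra K) :=
  Submodule.span (ToeplitzAlgebra K) {1 - y K * x K}

section modules

variable (M : Type u) [AddCommGroup M] [Module (ToeplitzAlgebra K) M]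

/-- The submodule `I M` of a left `R`-module `M`. -/
def IM : Submodule (ToeplitzAlgebra K) M :=
  (TwoSidedIdeal.asIdeal (I K)) • (⊤ : Submodule (ToeplitzAlgebra K) M)

/-- The set of all `d` such that `M = P ⊕ Q` for submodules `P`, `Q` with `P ≅ S₁ᵈ`. -/
def summandMultiplicities : Set ℕ :=
  {d | ∃ P Q : Submodule (ToeplitzAlgebra K) M,
    IsCompl P Q ∧ Nonempty (P ≃ₗ[ToeplitzAlgebra K] (Fin d → S K))}

/-- `d(M)`: the largest `d` such that `M = S₁ᵈ ⊕ M'` for some submodule `M'`. -/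
def d : ℕ := sSup (summandMultiplicities K M)

/-- `lf(M)`: the sum of all finite-dimensional submodules of `M`. -/
def lf [Module K M] [IsScalarTower K (ToeplitzAlgebra K) M] :
    Submodule (ToeplitzAlgebra K) M :=
  sSup {P | FiniteDimensional K P}

/-- The modules with `I M = 0`, that is, the modules over `R / I = K[x, x⁻¹]`. -/
class KilledByI : Prop where
  smul_eq_zero : ∀ a ∈ I K, ∀ m : M, a • m = 0

theorem killedByI_of_forall (h : ∀ m : M, y K • x K • m = m) : KilledByI K M := by
  refine ⟨fun a ha m => ?_⟩
  have hle : I K ≤ TwoSidedIdeal.ker (Module.toAddMonoidEnd (ToeplitzAlgebra K) M) := by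
    rw [I, TwoSidedIdeal.span_le]
    intro b hb
    rw [Set.mem_singleton_iff] at hb
    subst hb
    rw [SetLike.mem_coe, TwoSidedIdeal.mem_ker]
    ext m
    change (1 - y K * x K) • m = 0
    rw [sub_smul, one_smul, mul_smul, h, sub_self]
  have h0 := hle ha
  rw [TwoSidedIdeal.mem_ker] at h0
  exact DFunLike.congr_fun h0 m

variable {K} in
theorem y_smul_x_smul [h : KilledByI K M] (m : M) : y K • x K • m = m := by
  have h0 := h.smul_eq_zero (1 - y K * x K) (TwoSidedIdeal.subset_span (Set.mem_singleton _)) m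
  rw [sub_smul, one_smul, mul_smul, sub_eq_zero] at h0
  exact h0.symm

variable {K} in
theorem x_smul_y_smul (m : M) : x K • y K • m = m := by
  rw [← mul_smul, x_mul_y, one_smul]

instance killedByI_quotient : KilledByI K (M ⧸ IM K M) := by
  refine ⟨fun a ha m => ?_⟩
  obtain ⟨m, rfl⟩ := Submodule.Quotient.mk_surjective _ m
  rw [← Submodule.Quotient.mk_smul, Submodule.Quotient.mk_eq_zero]
  exact Submodule.smul_mem_smul (by simpa using ha) Submodule.mem_top

variable [Module K M] [IsScalarTower K (ToeplitzAlgebra K) M]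

instance killedByI_of_finiteDimensional [FiniteDimensional K M] : KilledByI K M := by
  refine killedByI_of_forall K M fun m => ?_
  have h : Module.toModuleEnd K M (x K) * Module.toModuleEnd K M (y K) = 1 := by
    rw [← map_mul, x_mul_y, map_one]
  exact DFunLike.congr_fun (mul_eq_one_comm.mp h) m

instance killedByI_lf : KilledByI K (lf K M) := by
  have key : lf K M ≤
      { carrier := {m : M | ∀ a ∈ I K, a • m = 0}
        add_mem' := fun hb hc a ha => by rw [smul_add, hb a ha, hc a ha, add_zero]
        zero_mem' := fun a _ => smul_zero a
        smul_mem' := fun r m hm a ha => by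
          rw [← mul_smul]; exact hm _ ((I K).mul_mem_right a r ha) } := by
    refine sSup_le fun P hP m hm a ha => ?_
    have : FiniteDimensional K P := hP
    exact congrArg Subtype.val (KilledByI.smul_eq_zero a ha (⟨m, hm⟩ : P))
  exact ⟨fun a ha m => Subtype.ext (key m.2 a ha)⟩

/-- On a module with `I M = 0` the element `x` acts invertibly, with inverse `y`. -/
def xUnit [KilledByI K M] : (Module.End K M)ˣ where
  val := Module.toModuleEnd K M (x K)
  inv := Module.toModuleEnd K M (y K)
  val_inv := by ext m; exact x_smul_y_smul M m
  inv_val := by ext m; exact y_smul_x_smul M m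

/-- The action of the Laurent polynomials on a module with `I M = 0`: the variable acts as `x`,
its inverse as `y`. -/
def laurentAction [KilledByI K M] : K[T;T⁻¹] →ₐ[K] Module.End K M :=
  AddMonoidAlgebra.lift K (Module.End K M) ℤ
    ((Units.coeHom (Module.End K M)).comp (zpowersHom _ (xUnit K M)))

instance laurentModule [KilledByI K M] : Module K[T;T⁻¹] M :=
  Module.compHom M (laurentAction K M).toRingHom

theorem laurent_smul_def [KilledByI K M] (p : K[T;T⁻¹]) (m : M) :
    p • m = laurentAction K M p m := rfl

instance laurent_isScalarTower [KilledByI K M] : IsScalarTower K K[T;T⁻¹] M :=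
  ⟨fun c p m => by rw [laurent_smul_def, map_smul, laurent_smul_def, LinearMap.smul_apply]⟩

theorem T_one_smul [KilledByI K M] (m : M) :
    (LaurentPolynomial.T 1 : K[T;T⁻¹]) • m = x K • m := by
  rw [laurent_smul_def, laurentAction, LaurentPolynomial.T, AddMonoidAlgebra.lift_single]
  simp [xUnit]

theorem T_neg_one_smul [KilledByI K M] (m : M) :
    (LaurentPolynomial.T (-1) : K[T;T⁻¹]) • m = y K • m := by
  rw [laurent_smul_def, laurentAction, LaurentPolynomial.T, AddMonoidAlgebra.lift_single]
  simp [xUnit]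

end modules

/-- `Ext¹_A(X, Y)` in the category of left modules over a ring `A`. -/
abbrev Ext1 (A : Type u) [Ring A] (X Y : Type u) [AddCommGroup X] [Module A X]
    [AddCommGroup Y] [Module A Y] : Type u :=
  Abelian.Ext.{u} (ModuleCat.of A X) (ModuleCat.of A Y) 1

/-- The length `ℓ(M)`, as a natural number (for modules of finite length). -/
def len (A : Type u) [Ring A] (X : Type u) [AddCommGroup X] [Module A X] : ℕ :=
  (Module.length A X).toNat

end ToeplitzAlgebra

end

/-!
Extensions over the Toeplitz algebra `R` and over `K[T;T⁻¹]` are computed by one and the same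
complex. Both rings are `ℤ`-graded and generated by elements `x`, `y` with `x y = 1`, of degrees `-1`
and `1`. For a module `F` on which `y` is bijective, comparing homogeneous components shows that
`a ⊗ v ↦ a y ⊗ v - a ⊗ y v` is an injective endomorphism of the free module `A ⊗ F` with cokernel
`F` (`resolutionDifferential_injective`, `resolution_exact`). Hence `Ext²(F, N) = 0`, and
`Ext¹(F, N)` is the cokernel of `φ ↦ y φ - φ y` on `Hom_K(F, N)`
(`nonempty_ext_equiv_commutatorMap`). Neither the map nor the space mentions the ring, so `Ext¹` over
`R` and over `K[T;T⁻¹]` agree for modules killed by `I`.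

The submodule `I M` is the set of elements killed by a power of `x` (`mem_IM_iff`). A module `N`
consisting of such elements is determined by the vector space `ker x`: its submodules are the
subspaces of `ker x`, its homomorphisms are the linear maps between these kernels, and it is
projective (`torsionSubmoduleOrderIso`, `torsionHomEquiv`, `IsXTorsion.projective`). So `ℓ(I N)` is
the dimension of `ker x`, and `Hom(I M, N)` has dimension `ℓ(I M) ℓ(I N)`. As `ker x` on `S` is a
line, such an `N` of finite length is a power of `S`; this gives `d(M) = dim Hom(M, S)` and
`dim Hom(M, I N) = d(M) ℓ(I N)`. For finite-dimensional `F` there is no nonzero map `F → I N`, while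
`Ext¹(F, I N) ≅ Hom_K(F, ker x)` (`nonempty_ext1_equiv_of_isXTorsion`).

The four formulas are then the alternating sums of dimensions in the long exact `Ext` sequences of
`I N ⊆ N` and `I M ⊆ M`, all of whose terms beyond `Ext¹` vanish.
-/
noncomputable section

namespace ToeplitzAlgebra

/-! ### Dimension counts along exact sequences of `Ext` -/

/-- In an exact sequence `0 → V₁ → ⋯ → V₆ → 0` of vector spaces, finiteness of `V₁, V₃, V₄, V₆`
forces finiteness of `V₂` and `V₅`, and the alternating sum of the dimensions vanishes. -/
theorem finrank_of_six_term_exact {K V₁ V₂ V₃ V₄ V₅ V₆ : Type*} [Field K]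
    [AddCommGroup V₁] [Module K V₁] [AddCommGroup V₂] [Module K V₂]
    [AddCommGroup V₃] [Module K V₃] [AddCommGroup V₄] [Module K V₄]
    [AddCommGroup V₅] [Module K V₅] [AddCommGroup V₆] [Module K V₆]
    [FiniteDimensional K V₁] [FiniteDimensional K V₃]
    [FiniteDimensional K V₄] [FiniteDimensional K V₆]
    (f₁ : V₁ →ₗ[K] V₂) (f₂ : V₂ →ₗ[K] V₃) (f₃ : V₃ →ₗ[K] V₄) (f₄ : V₄ →ₗ[K] V₅)
    (f₅ : V₅ →ₗ[K] V₆) (h₁ : Function.Injective f₁) (h₁₂ : Function.Exact f₁ f₂)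
    (h₂₃ : Function.Exact f₂ f₃) (h₃₄ : Function.Exact f₃ f₄) (h₄₅ : Function.Exact f₄ f₅)
    (h₅ : Function.Surjective f₅) :
    FiniteDimensional K V₂ ∧ FiniteDimensional K V₅ ∧
      (Module.finrank K V₂ : ℤ) + Module.finrank K V₄ + Module.finrank K V₆ =
        Module.finrank K V₁ + Module.finrank K V₃ + Module.finrank K V₅ := by
  rw [LinearMap.exact_iff] at h₁₂ h₂₃ h₃₄ h₄₅
  have fin2 : FiniteDimensional K V₂ := by
    have : Module.Finite K (LinearMap.ker f₂) := by rw [h₁₂]; infer_instance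
    have : Module.Finite K (V₂ ⧸ LinearMap.ker f₂) :=
      Module.Finite.equiv f₂.quotKerEquivRange.symm
    exact Module.Finite.of_submodule_quotient (LinearMap.ker f₂)
  have fin5 : FiniteDimensional K V₅ := by
    have : Module.Finite K (LinearMap.ker f₅) := by rw [h₄₅]; infer_instance
    have : Module.Finite K (V₅ ⧸ LinearMap.ker f₅) :=
      Module.Finite.equiv f₅.quotKerEquivRange.symm
    exact Module.Finite.of_submodule_quotient (LinearMap.ker f₅)
  refine ⟨fin2, fin5, ?_⟩
  have e₁ := LinearMap.finrank_range_of_inj h₁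
  have e₂ := f₂.finrank_range_add_finrank_ker
  have e₃ := f₃.finrank_range_add_finrank_ker
  have e₄ := f₄.finrank_range_add_finrank_ker
  have e₅ := f₅.finrank_range_add_finrank_ker
  rw [LinearMap.range_eq_top.mpr h₅, finrank_top] at e₅
  rw [h₁₂] at e₂
  rw [h₂₃] at e₃
  rw [h₃₄] at e₄
  rw [h₄₅] at e₅
  lia

section Ext

variable {K : Type u} [Field K] {A : Type u} [Ring A] [Algebra K A]

theorem homEquiv₀_smul {C : Type*} [Category* C] [Abelian C] [HasExt.{u} C] [Linear K C]
    {X Y : C} (c : K) (e : Abelian.Ext.{u} X Y 0) :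
    Abelian.Ext.homEquiv₀ (c • e) = c • Abelian.Ext.homEquiv₀ e :=
  map_smul (Abelian.Ext.linearEquiv₀ (R := K)) c e

/-- `Ext⁰` is `Hom`, compatibly with the scalars in `K`. The `K`-structure on `Ext` comes from the
algebra map `K → A`, that on `Hom` from the scalar multiplication of the target. -/
def extZeroEquiv (X Y : Type u) [AddCommGroup X] [Module A X] [AddCommGroup Y] [Module K Y]
    [Module A Y] [IsScalarTower K A Y] :
    Abelian.Ext.{u} (ModuleCat.of A X) (ModuleCat.of A Y) 0 ≃ₗ[K] (X →ₗ[A] Y) where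
  toFun e := (Abelian.Ext.homEquiv₀ e).hom
  invFun f := Abelian.Ext.homEquiv₀.symm (ModuleCat.ofHom f)
  left_inv e := Abelian.Ext.homEquiv₀.symm_apply_apply e
  right_inv f := congrArg ModuleCat.Hom.hom
    (Abelian.Ext.homEquiv₀.apply_symm_apply (ModuleCat.ofHom f))
  map_add' e e' := congrArg ModuleCat.Hom.hom (map_add Abelian.Ext.addEquiv₀ e e')
  map_smul' c e := by
    ext v
    refine (congrArg (fun f => ModuleCat.Hom.hom f v) (homEquiv₀_smul c e)).trans ?_
    exact algebraMap_smul A c ((Abelian.Ext.homEquiv₀ e).hom v)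

/-- The short complex in `ModuleCat A` attached to an exact pair of `A`-linear maps. -/
abbrev shortComplexOfExact {X Y Z : Type u} [AddCommGroup X] [Module A X] [AddCommGroup Y]
    [Module A Y] [AddCommGroup Z] [Module A Z] (f : X →ₗ[A] Y) (g : Y →ₗ[A] Z)
    (h : Function.Exact f g) : ShortComplex (ModuleCat.{u} A) :=
  ShortComplex.mk (ModuleCat.ofHom f) (ModuleCat.ofHom g) (by
    ext v; exact h.apply_apply_eq_zero v)

theorem shortExact_shortComplexOfExact {X Y Z : Type u} [AddCommGroup X] [Module A X]
    [AddCommGroup Y] [Module A Y] [AddCommGroup Z] [Module A Z] {f : X →ₗ[A] Y} {g : Y →ₗ[A] Z}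
    (h : Function.Exact f g) (hf : Function.Injective f) (hg : Function.Surjective g) :
    (shortComplexOfExact f g h).ShortExact where
  exact := (ShortComplex.ShortExact.moduleCat_exact_iff_function_exact _).mpr h
  mono_f := (ModuleCat.mono_iff_injective _).mpr hf
  epi_g := (ModuleCat.epi_iff_surjective _).mpr hg

variable {X Y Z W : Type u} [AddCommGroup X] [Module A X] [AddCommGroup Y] [Module A Y]
  [AddCommGroup Z] [Module A Z] [AddCommGroup W] [Module A W]
  {f : X →ₗ[A] Y} {g : Y →ₗ[A] Z}

open Abelian in
/-- The Euler characteristic of the covariant sequence, cut off at degree one by `Ext²(W, X) = 0`. -/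
theorem finrank_ext_covariant [Module K X] [IsScalarTower K A X] [Module K Y] [IsScalarTower K A Y]
    [Module K Z] [IsScalarTower K A Z]
    (h : Function.Exact f g) (hf : Function.Injective f) (hg : Function.Surjective g)
    [Subsingleton (Ext.{u} (ModuleCat.of A W) (ModuleCat.of A X) 2)]
    [FiniteDimensional K (W →ₗ[A] X)] [FiniteDimensional K (W →ₗ[A] Z)]
    [FiniteDimensional K (Ext1 A W X)] [FiniteDimensional K (Ext1 A W Z)] :
    FiniteDimensional K (W →ₗ[A] Y) ∧ FiniteDimensional K (Ext1 A W Y) ∧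
      (Module.finrank K (W →ₗ[A] Y) : ℤ) + Module.finrank K (Ext1 A W X) +
        Module.finrank K (Ext1 A W Z) =
      Module.finrank K (W →ₗ[A] X) + Module.finrank K (W →ₗ[A] Z) +
        Module.finrank K (Ext1 A W Y) := by
  have hS := shortExact_shortComplexOfExact h hf hg
  have := Module.Finite.equiv (extZeroEquiv (K := K) (A := A) W X).symm
  have := Module.Finite.equiv (extZeroEquiv (K := K) (A := A) W Z).symm
  obtain ⟨h1, h2, h3⟩ := finrank_of_six_term_exact
    (Ext.postcompOfLinear (Ext.mk₀ (ModuleCat.ofHom f)) K (ModuleCat.of A W) (add_zero 0))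
    (Ext.postcompOfLinear (Ext.mk₀ (ModuleCat.ofHom g)) K (ModuleCat.of A W) (add_zero 0))
    (Ext.postcompOfLinear hS.extClass K (ModuleCat.of A W) (zero_add 1))
    (Ext.postcompOfLinear (Ext.mk₀ (ModuleCat.ofHom f)) K (ModuleCat.of A W) (add_zero 1))
    (Ext.postcompOfLinear (Ext.mk₀ (ModuleCat.ofHom g)) K (ModuleCat.of A W) (add_zero 1))
    (by
      have := hS.mono_f
      exact Ext.postcomp_mk₀_injective_of_mono (ModuleCat.of A W) (ModuleCat.ofHom f))
    ((ShortComplex.ab_exact_iff_function_exact _).mp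
      (Ext.covariant_sequence_exact₂' (ModuleCat.of A W) hS 0))
    ((ShortComplex.ab_exact_iff_function_exact _).mp
      (Ext.covariant_sequence_exact₃' (ModuleCat.of A W) hS 0 1 rfl))
    ((ShortComplex.ab_exact_iff_function_exact _).mp
      (Ext.covariant_sequence_exact₁' (ModuleCat.of A W) hS 0 1 rfl))
    ((ShortComplex.ab_exact_iff_function_exact _).mp
      (Ext.covariant_sequence_exact₂' (ModuleCat.of A W) hS 1))
    (fun e => Ext.covariant_sequence_exact₃ (ModuleCat.of A W) hS e (n₁ := 2) rfl
      (Subsingleton.elim _ _))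
  refine ⟨Module.Finite.equiv (extZeroEquiv (K := K) (A := A) W Y), h2, ?_⟩
  rw [← (extZeroEquiv (K := K) (A := A) W X).finrank_eq,
    ← (extZeroEquiv (K := K) (A := A) W Y).finrank_eq,
    ← (extZeroEquiv (K := K) (A := A) W Z).finrank_eq]
  exact h3

open Abelian in
/-- The Euler characteristic of the contravariant sequence, cut off at degree one by
`Ext¹(X, W) = 0`. -/
theorem finrank_ext_contravariant [Module K W] [IsScalarTower K A W]
    (h : Function.Exact f g) (hf : Function.Injective f) (hg : Function.Surjective g)
    [Subsingleton (Ext1 A X W)]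
    [FiniteDimensional K (Z →ₗ[A] W)] [FiniteDimensional K (X →ₗ[A] W)]
    [FiniteDimensional K (Ext1 A Z W)] :
    FiniteDimensional K (Y →ₗ[A] W) ∧ FiniteDimensional K (Ext1 A Y W) ∧
      (Module.finrank K (Y →ₗ[A] W) : ℤ) + Module.finrank K (Ext1 A Z W) =
      Module.finrank K (Z →ₗ[A] W) + Module.finrank K (X →ₗ[A] W) +
        Module.finrank K (Ext1 A Y W) := by
  have hS := shortExact_shortComplexOfExact h hf hg
  have := Module.Finite.equiv (extZeroEquiv (K := K) (A := A) Z W).symm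
  have := Module.Finite.equiv (extZeroEquiv (K := K) (A := A) X W).symm
  obtain ⟨h1, h2, h3⟩ := finrank_of_six_term_exact
    (Ext.precompOfLinear (Ext.mk₀ (ModuleCat.ofHom g)) K (ModuleCat.of A W) (zero_add 0))
    (Ext.precompOfLinear (Ext.mk₀ (ModuleCat.ofHom f)) K (ModuleCat.of A W) (zero_add 0))
    (Ext.precompOfLinear hS.extClass K (ModuleCat.of A W) (add_zero 1))
    (Ext.precompOfLinear (Ext.mk₀ (ModuleCat.ofHom g)) K (ModuleCat.of A W) (zero_add 1))
    (Ext.precompOfLinear (Ext.mk₀ (ModuleCat.ofHom f)) K (ModuleCat.of A W) (zero_add 1))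
    (by
      have := hS.epi_g
      exact Ext.precomp_mk₀_injective_of_epi (ModuleCat.of A W) (ModuleCat.ofHom g))
    ((ShortComplex.ab_exact_iff_function_exact _).mp
      (Ext.contravariant_sequence_exact₂' hS (ModuleCat.of A W) 0))
    ((ShortComplex.ab_exact_iff_function_exact _).mp
      (Ext.contravariant_sequence_exact₁' hS (ModuleCat.of A W) 0 1 rfl))
    ((ShortComplex.ab_exact_iff_function_exact _).mp
      (Ext.contravariant_sequence_exact₃' hS (ModuleCat.of A W) 0 1 rfl))
    ((ShortComplex.ab_exact_iff_function_exact _).mp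
      (Ext.contravariant_sequence_exact₂' hS (ModuleCat.of A W) 1))
    (fun e => ⟨0, Subsingleton.elim _ _⟩)
  refine ⟨Module.Finite.equiv (extZeroEquiv (K := K) (A := A) Y W), h2, ?_⟩
  rw [← (extZeroEquiv (K := K) (A := A) X W).finrank_eq,
    ← (extZeroEquiv (K := K) (A := A) Y W).finrank_eq,
    ← (extZeroEquiv (K := K) (A := A) Z W).finrank_eq]
  have : Module.finrank K (Ext1 A X W) = 0 := Module.finrank_zero_of_subsingleton
  rw [this] at h3
  simpa using h3

theorem subsingleton_ext_of_projective (P N : Type u) [AddCommGroup P] [Module A P]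
    [Module.Projective A P] [AddCommGroup N] [Module A N] (n : ℕ) :
    Subsingleton (Abelian.Ext.{u} (ModuleCat.of A P) (ModuleCat.of A N) (n + 1)) :=
  have : Projective (ModuleCat.of A P) := (IsProjective.iff_projective P).mp inferInstance
  Abelian.Ext.subsingleton_of_projective _ _ n

theorem subsingleton_ext_two_of_exact (h : Function.Exact f g) (hf : Function.Injective f)
    (hg : Function.Surjective g)
    (hX : Subsingleton (Abelian.Ext.{u} (ModuleCat.of A X) (ModuleCat.of A W) 1))
    (hY : Subsingleton (Abelian.Ext.{u} (ModuleCat.of A Y) (ModuleCat.of A W) 2)) :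
    Subsingleton (Abelian.Ext.{u} (ModuleCat.of A Z) (ModuleCat.of A W) 2) := by
  refine subsingleton_of_forall_eq 0 fun e => ?_
  have hS := shortExact_shortComplexOfExact h hf hg
  obtain ⟨e', rfl⟩ := Abelian.Ext.contravariant_sequence_exact₃ hS (ModuleCat.of A W) e
    (Subsingleton.elim _ _) (n₀ := 1) rfl
  rw [Subsingleton.elim e' 0, Abelian.Ext.comp_zero]

end Ext

/-! ### A free resolution of length one -/

open scoped TensorProduct

/-- The algebra `A` is generated by `x` and `y` with `x y = 1`, and carries a `ℤ`-grading in which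
`x` and `y` have degrees `-1` and `1`. The grading is encoded as the coaction
`a ↦ ∑ aₙ Tⁿ` of the Laurent polynomials. Both the Toeplitz algebra and `K[T;T⁻¹]` are
examples. -/
structure IsGradedPair (K : Type*) [Field K] {A : Type*} [Ring A] [Algebra K A] (x y : A) :
    Prop where
  mul_eq_one : x * y = 1
  adjoin_eq_top : Algebra.adjoin K {x, y} = ⊤
  exists_coaction : ∃ δ : A →ₐ[K] A[T;T⁻¹],
    δ x = AddMonoidAlgebra.single (-1) x ∧ δ y = AddMonoidAlgebra.single 1 y

namespace IsGradedPair

variable {K : Type*} [Field K] {A : Type*} [Ring A] [Algebra K A] {x y : A}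

theorem induction (h : IsGradedPair K x y) {p : A → Prop} (hx : p x) (hy : p y)
    (algebraMap : ∀ c, p (algebraMap K A c)) (add : ∀ a b, p a → p b → p (a + b))
    (mul : ∀ a b, p a → p b → p (a * b)) (a : A) : p a := by
  have ha : a ∈ Algebra.adjoin K {x, y} := by rw [h.adjoin_eq_top]; trivial
  induction ha using Algebra.adjoin_induction with
  | mem b hb =>
    obtain rfl | rfl := hb
    · exact hx
    · exact hy
  | algebraMap c => exact algebraMap c
  | add a b _ _ ha hb => exact add a b ha hb
  | mul a b _ _ ha hb => exact mul a b ha hb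

/-- The homogeneous components of an element of a graded algebra: they are finite in number, add
up to the element, and are shifted by right multiplication with the element `y` of degree one. -/
theorem exists_components (h : IsGradedPair K x y) :
    ∃ c : ℤ → A →ₗ[K] A, (∀ n a, c n (a * y) = c (n - 1) a * y) ∧
      ∀ a, ∃ s : Finset ℤ, (∀ n ∉ s, c n a = 0) ∧ ∑ n ∈ s, c n a = a := by
  obtain ⟨δ, hx, hy⟩ := h.exists_coaction
  let coeff (n : ℤ) : A[T;T⁻¹] →ₗ[K] A :=
    { toFun p := p.coeff n
      map_add' _ _ := rfl
      map_smul' _ _ := rfl }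
  let ε : A[T;T⁻¹] →+* A :=
    AddMonoidAlgebra.liftNCRingHom (RingHom.id A) (1 : Multiplicative ℤ →* A)
      (fun _ _ => Commute.one_right _)
  have hε (p : A[T;T⁻¹]) : ε p = p.coeff.sum fun _ a => a := by
    change AddMonoidAlgebra.liftNC _ _ p = _
    simp [AddMonoidAlgebra.liftNC]
  have hεs (n : ℤ) (a : A) : ε (AddMonoidAlgebra.single n a) = a := by
    rw [hε]; exact Finsupp.sum_single_index rfl
  have hεδ (a : A) : ε (δ a) = a := by
    induction a using h.induction with
    | hx => rw [hx, hεs]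
    | hy => rw [hy, hεs]
    | algebraMap c =>
      rw [AlgHom.commutes]
      exact hεs 0 _
    | add a b ha hb => rw [map_add, map_add, ha, hb]
    | mul a b ha hb => rw [map_mul, map_mul, ha, hb]
  refine ⟨fun n => coeff n ∘ₗ δ.toLinearMap, fun n a => ?_, fun a => ?_⟩
  · change (δ (a * y)).coeff n = (δ a).coeff (n - 1) * y
    rw [map_mul, hy, AddMonoidAlgebra.coeff_mul_single_apply]
    simp [sub_eq_add_neg]
  · refine ⟨(δ a).coeff.support, fun n hn => Finsupp.notMem_support_iff.mp hn, ?_⟩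
    conv_rhs => rw [← hεδ a, hε]
    rfl

end IsGradedPair

section Resolution

variable {K : Type*} [Field K] {A : Type*} [Ring A] [Algebra K A] (x y : A)
  (F : Type*) [AddCommGroup F] [Module K F]
  (N : Type*) [AddCommGroup N] [Module K N] [Module A N] [IsScalarTower K A N]

variable (K A) in
/-- Extension of scalars is left adjoint to restriction. -/
def tensorHomEquiv : (F →ₗ[K] N) ≃ₗ[K] (A ⊗[K] F →ₗ[A] N) where
  toFun φ := TensorProduct.AlgebraTensorModule.lift (LinearMap.toSpanSingleton A (F →ₗ[K] N) φ)
  invFun ψ := ψ.restrictScalars K ∘ₗ TensorProduct.mk K A F 1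
  left_inv φ := by ext v; simp
  right_inv ψ := by
    ext v
    simp
  map_add' φ ψ := by ext v; simp
  map_smul' c φ := by ext v; simp

variable {F N} in
@[simp]
theorem tensorHomEquiv_tmul (φ : F →ₗ[K] N) (a : A) (v : F) :
    tensorHomEquiv K A F N φ (a ⊗ₜ v) = a • φ v := by
  simp [tensorHomEquiv]

variable [Module A F] [IsScalarTower K A F]

variable (K) in
/-- The endomorphism `a ⊗ v ↦ a y ⊗ v - a ⊗ y v` of the free module `A ⊗ F`. -/
def resolutionDifferential : A ⊗[K] F →ₗ[A] A ⊗[K] F :=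
  TensorProduct.AlgebraTensorModule.map (LinearMap.toSpanSingleton A A y) LinearMap.id -
    TensorProduct.AlgebraTensorModule.map LinearMap.id (Module.toModuleEnd K F y)

@[simp]
theorem resolutionDifferential_tmul (a : A) (v : F) :
    resolutionDifferential K y F (a ⊗ₜ v) = (a * y) ⊗ₜ v - a ⊗ₜ (y • v) := by
  simp [resolutionDifferential]

variable (K A) in
/-- The action map `a ⊗ v ↦ a v`. -/
def resolutionAugmentation : A ⊗[K] F →ₗ[A] F :=
  TensorProduct.AlgebraTensorModule.lift (LinearMap.toSpanSingleton A (F →ₗ[K] F) LinearMap.id)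

@[simp]
theorem resolutionAugmentation_tmul (a : A) (v : F) :
    resolutionAugmentation K A F (a ⊗ₜ v) = a • v := by
  simp [resolutionAugmentation]

theorem resolutionAugmentation_surjective :
    Function.Surjective (resolutionAugmentation K A F) :=
  fun v => ⟨1 ⊗ₜ v, by simp⟩

variable {x y}

/-- If `y` acts injectively on `F`, then the differential is injective: comparing the components
of degree `n`, an element of the kernel has `uₙ₋₁ y = y uₙ`, so all its components vanish once
those of very negative degree do. -/
theorem resolutionDifferential_injective (h : IsGradedPair K x y)
    (hy : Function.Injective fun v : F => y • v) :
    Function.Injective (resolutionDifferential K y F) := by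
  obtain ⟨c, hc, hs⟩ := h.exists_components
  let C (n : ℤ) : A ⊗[K] F →ₗ[K] A ⊗[K] F := (c n).rTensor F
  let Y : A ⊗[K] F →ₗ[K] A ⊗[K] F := (Module.toModuleEnd K F y).lTensor A
  let R : A ⊗[K] F →ₗ[K] A ⊗[K] F := (LinearMap.mulRight K y).rTensor F
  have hY : Function.Injective Y := Module.Flat.lTensor_preserves_injective_linearMap _ hy
  have hd (u) : resolutionDifferential K y F u = R u - Y u := by
    induction u with
    | zero => simp
    | add u v hu hv => rw [map_add, map_add, map_add, hu, hv]; abel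
    | tmul a v => simp [R, Y]
  have hCR (n) (u) : C n (R u) = R (C (n - 1) u) := by
    induction u with
    | zero => simp
    | add u v hu hv => simp only [map_add, hu, hv]
    | tmul a v => simp [R, C, hc]
  have hCY (n) (u) : C n (Y u) = Y (C n u) := by
    induction u with
    | zero => simp
    | add u v hu hv => simp only [map_add, hu, hv]
    | tmul a v => simp [Y, C]
  have hfin (u) : ∃ s : Finset ℤ, (∀ n ∉ s, C n u = 0) ∧ ∑ n ∈ s, C n u = u := by
    induction u with
    | zero => exact ⟨∅, by simp⟩
    | add u v hu hv =>
      obtain ⟨s, hs, hs'⟩ := hu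
      obtain ⟨t, ht, ht'⟩ := hv
      refine ⟨s ∪ t, fun n hn => ?_, ?_⟩
      · rw [Finset.mem_union, not_or] at hn
        rw [map_add, hs n hn.1, ht n hn.2, add_zero]
      · simp only [map_add, Finset.sum_add_distrib]
        rw [← Finset.sum_subset Finset.subset_union_left fun n _ hn => hs n hn,
          ← Finset.sum_subset Finset.subset_union_right fun n _ hn => ht n hn, hs', ht']
    | tmul a v =>
      obtain ⟨s, hs, hs'⟩ := hs a
      refine ⟨s, fun n hn => ?_, ?_⟩
      · simp [C, hs n hn]
      · simp only [C, LinearMap.rTensor_tmul]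
        rw [← TensorProduct.sum_tmul, hs']
  rw [← LinearMap.ker_eq_bot, LinearMap.ker_eq_bot']
  intro u hu
  rw [hd, sub_eq_zero] at hu
  obtain ⟨s, hs, hsum⟩ := hfin u
  have step (n : ℤ) (hn : C (n - 1) u = 0) : C n u = 0 := by
    apply hY
    rw [← hCY, ← hu, hCR, hn, map_zero, map_zero]
  obtain ⟨m, hm⟩ := s.bddBelow
  have hlow (n : ℤ) (hn : n < m) : C n u = 0 :=
    hs n fun hns => absurd (hm hns) (not_le.mpr hn)
  have hall (k : ℕ) : C (m - 1 + k) u = 0 := by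
    induction k with
    | zero => exact hlow _ (by lia)
    | succ k ih =>
      apply step
      rw [← ih]
      congr 2
      push_cast
      ring
  rw [← hsum]
  refine Finset.sum_eq_zero fun n hn => ?_
  have := hall (n - (m - 1)).toNat
  have hmn : m ≤ n := hm hn
  rwa [Int.toNat_of_nonneg (by lia), add_sub_cancel] at this

/-- If `y` acts surjectively on `F`, every `a ⊗ v` is congruent to `1 ⊗ a v` modulo the image of
the differential. For `a = x` this uses `v = y w` and `x y = 1`. -/
theorem resolution_exact (h : IsGradedPair K x y)
    (hy : Function.Surjective fun v : F => y • v) :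
    Function.Exact (resolutionDifferential K y F) (resolutionAugmentation K A F) := by
  have key (a : A) : ∀ v : F,
      a ⊗ₜ v - 1 ⊗ₜ (a • v) ∈ LinearMap.range (resolutionDifferential K y F) := by
    induction a using h.induction with
    | hx =>
      intro v
      obtain ⟨w, rfl⟩ := hy v
      refine ⟨-(x ⊗ₜ w), ?_⟩
      simp [← mul_smul, h.mul_eq_one]
    | hy => exact fun v => ⟨1 ⊗ₜ v, by simp⟩
    | algebraMap c =>
      intro v
      rw [algebraMap_smul, Algebra.algebraMap_eq_smul_one, TensorProduct.smul_tmul, sub_self]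
      exact zero_mem _
    | add a b ha hb =>
      intro v
      convert add_mem (ha v) (hb v) using 1
      rw [TensorProduct.add_tmul, add_smul, TensorProduct.tmul_add]
      abel
    | mul a b ha hb =>
      intro v
      convert add_mem (Submodule.smul_mem _ a (hb v)) (ha (b • v)) using 1
      simp [smul_sub, TensorProduct.smul_tmul', mul_smul]
  rw [LinearMap.exact_iff]
  apply le_antisymm
  · intro u hu
    rw [LinearMap.mem_ker] at hu
    have : ∀ u : A ⊗[K] F, u - 1 ⊗ₜ resolutionAugmentation K A F u ∈
        LinearMap.range (resolutionDifferential K y F) := by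
      intro u
      induction u with
      | zero => simp
      | add u v hu hv =>
        convert add_mem hu hv using 1
        rw [map_add, TensorProduct.tmul_add]
        abel
      | tmul a v => simpa using key a v
    simpa [hu] using this u
  · rintro _ ⟨u, rfl⟩
    rw [LinearMap.mem_ker]
    induction u with
    | zero => simp
    | add u v hu hv => rw [map_add, map_add, hu, hv, add_zero]
    | tmul a v => simp [mul_smul]

variable (K y) in
/-- The map `φ ↦ y φ - φ y` on the linear maps `F → N`. -/
def commutatorMap : (F →ₗ[K] N) →ₗ[K] (F →ₗ[K] N) where
  toFun φ := Module.toModuleEnd K N y ∘ₗ φ - φ ∘ₗ Module.toModuleEnd K F y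
  map_add' φ ψ := by ext v; simp; abel
  map_smul' c φ := by ext v; simp [smul_sub]

@[simp]
theorem commutatorMap_apply (φ : F →ₗ[K] N) (v : F) :
    commutatorMap K y F N φ v = y • φ v - φ (y • v) := rfl

theorem tensorHomEquiv_comp_resolutionDifferential (φ : F →ₗ[K] N) :
    tensorHomEquiv K A F N φ ∘ₗ resolutionDifferential K y F =
      tensorHomEquiv K A F N (commutatorMap K y F N φ) := by
  ext v
  simp

end Resolution

section ExtComputation

variable {K : Type u} [Field K] {A : Type u} [Ring A] [Algebra K A] {x y : A}
  (F : Type u) [AddCommGroup F] [Module K F] [Module A F] [IsScalarTower K A F]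
  (N : Type u) [AddCommGroup N] [Module A N]

theorem subsingleton_ext_two (h : IsGradedPair K x y)
    (hy : Function.Bijective fun v : F => y • v) :
    Subsingleton (Abelian.Ext.{u} (ModuleCat.of A F) (ModuleCat.of A N) 2) :=
  subsingleton_ext_two_of_exact (resolution_exact F h hy.2)
    (resolutionDifferential_injective F h hy.1) (resolutionAugmentation_surjective F)
    (subsingleton_ext_of_projective _ _ 0) (subsingleton_ext_of_projective _ _ 1)

variable [Module K N] [IsScalarTower K A N]

open Abelian in
/-- When `y` acts bijectively on `F`, the resolution identifies `Ext¹(F, N)` with the cokernel of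
`φ ↦ y φ - φ y` on `Hom_K(F, N)`. -/
theorem nonempty_ext_equiv_commutatorMap (h : IsGradedPair K x y)
    (hy : Function.Bijective fun v : F => y • v) :
    Nonempty (Ext1 A F N ≃ₗ[K] (F →ₗ[K] N) ⧸ LinearMap.range (commutatorMap K y F N)) := by
  have hS := shortExact_shortComplexOfExact (resolution_exact F h hy.2)
    (resolutionDifferential_injective F h hy.1) (resolutionAugmentation_surjective F)
  have := subsingleton_ext_of_projective (A ⊗[K] F) N (A := A) 0
  let e : (F →ₗ[K] N) ≃ₗ[K] Ext.{u} (ModuleCat.of A (A ⊗[K] F)) (ModuleCat.of A N) 0 :=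
    tensorHomEquiv K A F N ≪≫ₗ (extZeroEquiv (A ⊗[K] F) N).symm
  have he (φ : F →ₗ[K] N) : e φ = Ext.mk₀ (ModuleCat.ofHom (tensorHomEquiv K A F N φ)) := rfl
  let δ : (F →ₗ[K] N) →ₗ[K] Ext1 A F N :=
    Ext.precompOfLinear hS.extClass K (ModuleCat.of A N) (add_zero 1) ∘ₗ e.toLinearMap
  have hδ (φ : F →ₗ[K] N) : δ φ = hS.extClass.comp (e φ) (add_zero 1) := rfl
  have hcomp (φ : F →ₗ[K] N) : e (commutatorMap K y F N φ) =
      (Ext.mk₀ (ModuleCat.ofHom (resolutionDifferential K y F))).comp (e φ) (zero_add 0) := by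
    rw [he, he, Ext.mk₀_comp_mk₀, ← tensorHomEquiv_comp_resolutionDifferential]
    rfl
  have hsurj : Function.Surjective δ := by
    intro z
    obtain ⟨w, hw⟩ := Ext.contravariant_sequence_exact₃ hS (ModuleCat.of A N) z
      (Subsingleton.elim _ _) (n₀ := 0) rfl
    exact ⟨e.symm w, by rw [hδ, e.apply_symm_apply, hw]⟩
  have hker : LinearMap.ker δ = LinearMap.range (commutatorMap K y F N) := by
    ext φ
    rw [LinearMap.mem_ker, hδ, LinearMap.mem_range]
    constructor
    · intro hφ
      obtain ⟨w, hw⟩ := Ext.contravariant_sequence_exact₁ hS (ModuleCat.of A N) (e φ) rfl hφ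
      refine ⟨e.symm w, e.injective ?_⟩
      rw [hcomp, e.apply_symm_apply]
      exact hw
    · rintro ⟨ψ, rfl⟩
      rw [hcomp]
      exact hS.extClass_comp_assoc _
  exact ⟨(δ.quotKerEquivOfSurjective hsurj).symm ≪≫ₗ Submodule.quotEquivOfEq _ _ hker⟩

end ExtComputation

/-! ### The Toeplitz algebra and the Laurent polynomials as graded algebras -/

section Generators

variable (K : Type u) [Field K]

theorem isGradedPair : IsGradedPair K (x K) (y K) where
  mul_eq_one := x_mul_y K
  adjoin_eq_top := by
    have h := congrArg (Subalgebra.map (RingQuot.mkAlgHom K (ToeplitzRel K)))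
      (FreeAlgebra.adjoin_range_ι K (Fin 2))
    rw [AlgHom.map_adjoin, Algebra.map_top,
      (AlgHom.range_eq_top _).mpr (RingQuot.mkAlgHom_surjective K _), ← Set.range_comp] at h
    refine top_le_iff.mp (h.symm.le.trans (Algebra.adjoin_mono ?_))
    rintro _ ⟨i, rfl⟩
    fin_cases i
    · exact Or.inl rfl
    · exact Or.inr rfl
  exists_coaction := by
    let B := (ToeplitzAlgebra K)[T;T⁻¹]
    let X : B := AddMonoidAlgebra.single (-1) (x K)
    let Y : B := AddMonoidAlgebra.single 1 (y K)
    have hXY : X * Y = 1 := by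
      refine (AddMonoidAlgebra.single_mul_single _ _ _ _).trans ?_
      rw [x_mul_y]
      rfl
    let δ₀ : FreeAlgebra K (Fin 2) →ₐ[K] B := FreeAlgebra.lift K ![X, Y]
    let δ : RingQuot (ToeplitzRel K) →ₐ[K] B := RingQuot.liftAlgHom K ⟨δ₀, fun a b hab => by
      obtain ⟨⟩ := hab
      simp [δ₀, hXY]⟩
    refine ⟨δ, ?_, ?_⟩
    · refine (RingQuot.liftAlgHom_mkAlgHom_apply K (s := ToeplitzRel K) δ₀ _ _).trans ?_
      simp [δ₀, X]
    · refine (RingQuot.liftAlgHom_mkAlgHom_apply K (s := ToeplitzRel K) δ₀ _ _).trans ?_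
      simp [δ₀, Y]

theorem isGradedPair_laurent :
    IsGradedPair K (LaurentPolynomial.T 1 : K[T;T⁻¹]) (LaurentPolynomial.T (-1)) where
  mul_eq_one := by rw [← LaurentPolynomial.T_add]; simp
  adjoin_eq_top := by
    rw [eq_top_iff]
    intro p _
    induction p using LaurentPolynomial.induction_on' with
    | add p q hp hq => exact add_mem (hp trivial) (hq trivial)
    | C_mul_T n a =>
      refine mul_mem (Subalgebra.algebraMap_mem _ a) ?_
      obtain ⟨k, rfl | rfl⟩ := n.eq_nat_or_neg
      · have := LaurentPolynomial.T_pow (R := K) 1 k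
        rw [mul_one] at this
        rw [← this]
        exact pow_mem (Algebra.subset_adjoin (Set.mem_insert _ _)) k
      · have := LaurentPolynomial.T_pow (R := K) (-1) k
        rw [mul_neg_one] at this
        rw [← this]
        exact pow_mem (Algebra.subset_adjoin (Set.mem_insert_of_mem _ (Set.mem_singleton _))) k
  exists_coaction := by
    let g : Multiplicative ℤ →* K[T;T⁻¹][T;T⁻¹] :=
      { toFun n := AddMonoidAlgebra.single (-n.toAdd) (LaurentPolynomial.T n.toAdd)
        map_one' := rfl
        map_mul' m n := by
          rw [AddMonoidAlgebra.single_mul_single, ← LaurentPolynomial.T_add, toAdd_mul, neg_add] }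
    refine ⟨AddMonoidAlgebra.lift K _ ℤ g, ?_, ?_⟩
    · rw [LaurentPolynomial.T, AddMonoidAlgebra.lift_single, one_smul]
      rfl
    · rw [LaurentPolynomial.T, AddMonoidAlgebra.lift_single, one_smul]
      rfl

variable {K}

theorem IsGradedPair.map_smul {A : Type*} [Ring A] [Algebra K A] {a b : A}
    (h : IsGradedPair K a b) {M N : Type*} [AddCommGroup M] [Module K M] [Module A M]
    [IsScalarTower K A M] [AddCommGroup N] [Module K N] [Module A N] [IsScalarTower K A N]
    (φ : M →ₗ[K] N) (ha : ∀ m, φ (a • m) = a • φ m) (hb : ∀ m, φ (b • m) = b • φ m)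
    (r : A) : ∀ m, φ (r • m) = r • φ m := by
  induction r using h.induction with
  | hx => exact ha
  | hy => exact hb
  | algebraMap c => intro m; rw [algebraMap_smul, algebraMap_smul, _root_.map_smul]
  | add r s hr hs => intro m; rw [add_smul, add_smul, map_add, hr, hs]
  | mul r s hr hs => intro m; rw [mul_smul, mul_smul, hr, hs]

theorem IsGradedPair.smul_mem {A : Type*} [Ring A] [Algebra K A] {a b : A}
    (h : IsGradedPair K a b) {M : Type*} [AddCommGroup M] [Module K M] [Module A M]
    [IsScalarTower K A M] (W : Submodule K M) (ha : ∀ m ∈ W, a • m ∈ W)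
    (hb : ∀ m ∈ W, b • m ∈ W) (r : A) : ∀ m ∈ W, r • m ∈ W := by
  induction r using h.induction with
  | hx => exact ha
  | hy => exact hb
  | algebraMap c => intro m hm; rw [algebraMap_smul]; exact W.smul_mem c hm
  | add r s hr hs => intro m hm; rw [add_smul]; exact W.add_mem (hr m hm) (hs m hm)
  | mul r s hr hs => intro m hm; rw [mul_smul]; exact hr _ (hs m hm)

end Generators

section Modules

variable {K : Type u} [Field K]

/-! ### The submodule `I M` as the torsion of `x` -/

section Idempotent

variable {M : Type u} [AddCommGroup M] [Module (ToeplitzAlgebra K) M]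

theorem idem_smul (m : M) : (1 - y K * x K) • m = m - y K • x K • m := by
  rw [sub_smul, one_smul, mul_smul]

theorem x_smul_idem_smul (m : M) : x K • (1 - y K * x K) • m = 0 := by
  rw [idem_smul, smul_sub, x_smul_y_smul, sub_self]

theorem idem_smul_y_smul (m : M) : (1 - y K * x K) • y K • m = 0 := by
  rw [idem_smul, x_smul_y_smul, sub_self]

theorem idem_smul_of_x_smul_eq_zero {m : M} (h : x K • m = 0) : (1 - y K * x K) • m = m := by
  rw [idem_smul, h, smul_zero, sub_zero]

theorem idem_smul_add (m : M) : (1 - y K * x K) • m + y K • x K • m = m := by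
  rw [idem_smul, sub_add_cancel]

theorem x_pow_succ_smul_y_smul (k : ℕ) (m : M) : x K ^ (k + 1) • y K • m = x K ^ k • m := by
  rw [pow_succ, mul_smul, x_smul_y_smul]

theorem x_pow_smul_eq_zero_of_le {j k : ℕ} (hjk : j ≤ k) {m : M} (h : x K ^ j • m = 0) :
    x K ^ k • m = 0 := by
  obtain ⟨i, rfl⟩ := Nat.exists_eq_add_of_le' hjk
  rw [pow_add, mul_smul, h, smul_zero]

theorem idem_mem_I : 1 - y K * x K ∈ I K := TwoSidedIdeal.subset_span (Set.mem_singleton _)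

theorem idem_smul_mem_IM (m : M) : (1 - y K * x K) • m ∈ IM K M :=
  Submodule.smul_mem_smul (by simpa using idem_mem_I) Submodule.mem_top

/-- `I M` consists of the elements killed by a power of `x`. The latter form a submodule whose
quotient is killed by `1 - y x`; conversely `m = (1 - y x) m + y (x m)`. -/
theorem mem_IM_iff {m : M} : m ∈ IM K M ↔ ∃ k : ℕ, x K ^ k • m = 0 := by
  constructor
  · let W : Submodule (ToeplitzAlgebra K) M :=
      { carrier := {m | ∃ k : ℕ, x K ^ k • m = 0}
        zero_mem' := ⟨0, smul_zero _⟩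
        add_mem' := by
          rintro a b ⟨j, hj⟩ ⟨k, hk⟩
          exact ⟨max j k, by rw [smul_add, x_pow_smul_eq_zero_of_le (le_max_left _ _) hj,
            x_pow_smul_eq_zero_of_le (le_max_right _ _) hk, add_zero]⟩
        smul_mem' := by
          intro r
          induction r using (isGradedPair K).induction with
          | hx =>
            rintro m ⟨k, hk⟩
            exact ⟨k, by rw [← mul_smul, ← pow_succ, pow_succ', mul_smul, hk, smul_zero]⟩
          | hy =>
            rintro m ⟨k, hk⟩
            exact ⟨k + 1, by rw [x_pow_succ_smul_y_smul, hk]⟩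
          | algebraMap c =>
            rintro m ⟨k, hk⟩
            exact ⟨k, by rw [← mul_smul, ← Algebra.commutes, mul_smul, hk, smul_zero]⟩
          | add r s hr hs =>
            intro m hm
            obtain ⟨j, hj⟩ := hr hm
            obtain ⟨k, hk⟩ := hs hm
            exact ⟨max j k, by rw [add_smul, smul_add,
              x_pow_smul_eq_zero_of_le (le_max_left _ _) hj,
              x_pow_smul_eq_zero_of_le (le_max_right _ _) hk, add_zero]⟩
          | mul r s hr hs => intro m hm; rw [mul_smul]; exact hr (hs hm) }
    have hW : KilledByI K (M ⧸ W) := by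
      refine killedByI_of_forall K _ fun m => ?_
      obtain ⟨m, rfl⟩ := Submodule.Quotient.mk_surjective _ m
      rw [← Submodule.Quotient.mk_smul, ← Submodule.Quotient.mk_smul, eq_comm,
        Submodule.Quotient.eq, ← idem_smul]
      exact ⟨1, by rw [pow_one, x_smul_idem_smul]⟩
    have hle : IM K M ≤ W := by
      refine Submodule.smul_le.mpr fun a ha m _ => ?_
      rw [← Submodule.Quotient.mk_eq_zero, Submodule.Quotient.mk_smul]
      exact hW.smul_eq_zero a (by simpa using ha) _
    exact fun hm => hle hm
  · rintro ⟨k, hk⟩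
    induction k generalizing m with
    | zero =>
      rw [pow_zero, one_smul] at hk
      rw [hk]
      exact zero_mem _
    | succ k ih =>
      rw [← idem_smul_add (K := K) m]
      refine add_mem (idem_smul_mem_IM m) (Submodule.smul_mem _ _ (ih ?_))
      rw [← mul_smul, ← pow_succ, hk]

variable (K M) in
/-- Every element of `M` is killed by a power of `x`; equivalently `I M = M`. -/
def IsXTorsion : Prop := ∀ m : M, ∃ k : ℕ, x K ^ k • m = 0

variable (K M) in
theorem isXTorsion_IM : IsXTorsion K (IM K M) := fun m => by
  obtain ⟨k, hk⟩ := mem_IM_iff.mp m.2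
  exact ⟨k, Subtype.ext hk⟩

/-- Induction for torsion modules, along `m = (1 - y x) m + y (x m)`. -/
theorem IsXTorsion.induction (hM : IsXTorsion K M) {p : M → Prop} (zero : p 0)
    (step : ∀ m, p (x K • m) → p m) (m : M) : p m := by
  obtain ⟨k, hk⟩ := hM m
  induction k generalizing m with
  | zero =>
    rw [pow_zero, one_smul] at hk
    rwa [hk]
  | succ k ih => exact step m (ih _ (by rw [← mul_smul, ← pow_succ, hk]))

theorem eq_zero_of_x_smul_eq_zero [KilledByI K M] {m : M} (h : x K • m = 0) : m = 0 := by
  rw [← y_smul_x_smul (K := K) M m, h, smul_zero]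

theorem IM_eq_bot [KilledByI K M] : IM K M = ⊥ := by
  refine (Submodule.eq_bot_iff _).mpr fun m hm => ?_
  obtain ⟨k, hk⟩ := mem_IM_iff.mp hm
  induction k with
  | zero => rwa [pow_zero, one_smul] at hk
  | succ k ih =>
    rw [pow_succ', mul_smul] at hk
    exact ih (eq_zero_of_x_smul_eq_zero hk)

theorem y_smul_bijective [KilledByI K M] : Function.Bijective fun m : M => y K • m :=
  ⟨fun m n h => by
    have := congrArg (fun v => x K • v) h
    simpa only [x_smul_y_smul] using this, fun m => ⟨x K • m, y_smul_x_smul M m⟩⟩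

end Idempotent

/-! ### Torsion modules are determined by the kernel of `x` -/

section KerX

variable (K) in
/-- The kernel of `x` on a module, which is also the image of the idempotent `1 - y x`. -/
def kerX (M : Type u) [AddCommGroup M] [Module K M] [Module (ToeplitzAlgebra K) M]
    [IsScalarTower K (ToeplitzAlgebra K) M] : Submodule K M :=
  LinearMap.ker (Module.toModuleEnd K M (x K))

variable {M N : Type u} [AddCommGroup M] [Module K M] [Module (ToeplitzAlgebra K) M]
  [IsScalarTower K (ToeplitzAlgebra K) M] [AddCommGroup N] [Module K N]
  [Module (ToeplitzAlgebra K) N] [IsScalarTower K (ToeplitzAlgebra K) N]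

theorem mem_kerX {m : M} : m ∈ kerX K M ↔ x K • m = 0 := Iff.rfl

variable (K M) in
/-- The projection `m ↦ (1 - y x) m` onto the kernel of `x`. -/
def kerXProj : M →ₗ[K] kerX K M :=
  (Module.toModuleEnd K M (1 - y K * x K)).codRestrict _ fun m => x_smul_idem_smul m

theorem coe_kerXProj (m : M) : (kerXProj K M m : M) = (1 - y K * x K) • m := rfl

theorem kerXProj_coe (m : kerX K M) : kerXProj K M m = m :=
  Subtype.ext (idem_smul_of_x_smul_eq_zero m.2)

variable (M N) in
/-- Module homomorphisms preserve the kernel of `x`. -/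
def kerXRestrict : (M →ₗ[ToeplitzAlgebra K] N) →ₗ[K] (kerX K M →ₗ[K] kerX K N) where
  toFun ψ := (ψ.restrictScalars K).restrict fun m hm => by
    rw [mem_kerX] at hm ⊢
    rw [LinearMap.restrictScalars_apply, ← map_smul, hm, map_zero]
  map_add' _ _ := rfl
  map_smul' _ _ := rfl

theorem coe_kerXRestrict (ψ : M →ₗ[ToeplitzAlgebra K] N) (m : kerX K M) :
    (kerXRestrict M N ψ m : N) = ψ m := rfl

theorem kerXRestrict_injective (hM : IsXTorsion K M) :
    Function.Injective (kerXRestrict (K := K) M N) := by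
  rw [← LinearMap.ker_eq_bot, LinearMap.ker_eq_bot']
  intro ψ hψ
  ext m
  induction m using hM.induction with
  | zero => rw [map_zero, map_zero]
  | step m ih =>
    have h0 := congrArg Subtype.val (LinearMap.congr_fun hψ (kerXProj K M m))
    rw [coe_kerXRestrict, coe_kerXProj] at h0
    rw [← idem_smul_add (K := K) m, map_add, h0, map_smul ψ (y K), ih]
    simp

/-- A linear map between the kernels of `x` extends to a torsion module by
`m ↦ ∑ₖ yᵏ φ ((1 - y x) xᵏ m)`. -/
theorem kerXRestrict_surjective (hM : IsXTorsion K M) :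
    Function.Surjective (kerXRestrict (K := K) M N) := by
  intro φ
  let c (k : ℕ) : M →ₗ[K] N := Module.toModuleEnd K N (y K ^ k) ∘ₗ (kerX K N).subtype ∘ₗ φ ∘ₗ
    kerXProj K M ∘ₗ Module.toModuleEnd K M (x K ^ k)
  have hc (k : ℕ) (m : M) : c k m = y K ^ k • (φ (kerXProj K M (x K ^ k • m)) : N) := rfl
  have hc0 (k : ℕ) (m : M) (h : x K ^ k • m = 0) : c k m = 0 := by
    rw [hc, h]; simp
  have hle {j k : ℕ} (hjk : j ≤ k) {m : M} (h : x K ^ j • m = 0) :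
      ∑ i ∈ Finset.range j, c i m = ∑ i ∈ Finset.range k, c i m := by
    refine Finset.sum_subset (Finset.range_mono hjk) fun i _ hi => hc0 i m ?_
    exact x_pow_smul_eq_zero_of_le (by simpa using hi) h
  choose b hb using hM
  let f (m : M) : N := ∑ i ∈ Finset.range (b m), c i m
  have hf {m : M} {k : ℕ} (h : x K ^ k • m = 0) : f m = ∑ i ∈ Finset.range k, c i m := by
    obtain hk | hk := le_total k (b m)
    · exact (hle hk h).symm
    · exact hle hk (hb m)
  let g : M →ₗ[K] N :=
    { toFun := f
      map_add' m n := by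
        have hm := x_pow_smul_eq_zero_of_le (le_max_left (b m) (b n)) (hb m)
        have hn := x_pow_smul_eq_zero_of_le (le_max_right (b m) (b n)) (hb n)
        rw [hf hm, hf hn, hf (m := m + n) (by rw [smul_add, hm, hn, add_zero])]
        simp only [map_add, Finset.sum_add_distrib]
      map_smul' r m := by
        rw [hf (hb m), hf (m := r • m) (k := b m) (by rw [smul_comm, hb m, smul_zero])]
        simp only [map_smul, Finset.smul_sum, RingHom.id_apply] }
  have hgx (m : M) : g (x K • m) = x K • g m := by
    have h1 : x K ^ (b m + 1) • m = 0 := x_pow_smul_eq_zero_of_le (Nat.le_succ _) (hb m)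
    have h2 : x K ^ (b m) • x K • m = 0 := by rw [← mul_smul, ← pow_succ, h1]
    change f _ = x K • f m
    rw [hf h1, hf h2, Finset.sum_range_succ', smul_add, Finset.smul_sum]
    have h3 : x K • c 0 m = 0 := by
      rw [hc, pow_zero, one_smul]
      exact (φ (kerXProj K M (x K ^ 0 • m))).2
    rw [h3, add_zero]
    refine Finset.sum_congr rfl fun i _ => ?_
    rw [hc, hc, pow_succ' (y K), mul_smul, x_smul_y_smul, ← mul_smul, ← pow_succ]
  have hgy (m : M) : g (y K • m) = y K • g m := by
    have h1 : x K ^ (b m + 1) • y K • m = 0 := by rw [x_pow_succ_smul_y_smul, hb]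
    change f _ = y K • f m
    rw [hf h1, Finset.sum_range_succ', Finset.smul_sum]
    have h3 : c 0 (y K • m) = 0 := by
      have : kerXProj K M (x K ^ 0 • y K • m) = 0 :=
        Subtype.ext (by rw [coe_kerXProj, pow_zero, one_smul, idem_smul_y_smul]; rfl)
      rw [hc, this]; simp
    rw [h3, add_zero]
    refine Finset.sum_congr rfl fun i _ => ?_
    rw [hc, hc, pow_succ' (y K), mul_smul, x_pow_succ_smul_y_smul]
  refine ⟨{ g with map_smul' := (isGradedPair K).map_smul g hgx hgy }, ?_⟩
  ext m
  rw [coe_kerXRestrict]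
  change f m = _
  have h1 : x K ^ 1 • (m : M) = 0 := by rw [pow_one]; exact m.2
  rw [hf h1, Finset.sum_range_one, hc, pow_zero, pow_zero, one_smul, one_smul, kerXProj_coe]

/-- Homomorphisms out of a torsion module are the linear maps between the kernels of `x`. -/
def torsionHomEquiv (hM : IsXTorsion K M) :
    (M →ₗ[ToeplitzAlgebra K] N) ≃ₗ[K] (kerX K M →ₗ[K] kerX K N) :=
  LinearEquiv.ofBijective (kerXRestrict M N)
    ⟨kerXRestrict_injective hM, kerXRestrict_surjective hM⟩

theorem coe_torsionHomEquiv (hM : IsXTorsion K M) (ψ : M →ₗ[ToeplitzAlgebra K] N)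
    (m : kerX K M) : (torsionHomEquiv hM ψ m : N) = ψ m := rfl

/-- Torsion modules are isomorphic as soon as their kernels of `x` have the same dimension. -/
theorem IsXTorsion.nonempty_linearEquiv (hM : IsXTorsion K M) (hN : IsXTorsion K N)
    (e : kerX K M ≃ₗ[K] kerX K N) : Nonempty (M ≃ₗ[ToeplitzAlgebra K] N) := by
  let f := (torsionHomEquiv (N := N) hM).symm e
  let g := (torsionHomEquiv (N := M) hN).symm e.symm
  have hf (m : kerX K M) : f m = e m := by
    rw [← coe_torsionHomEquiv hM, LinearEquiv.apply_symm_apply]; rfl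
  have hg (n : kerX K N) : g n = e.symm n := by
    rw [← coe_torsionHomEquiv hN, LinearEquiv.apply_symm_apply]; rfl
  refine ⟨LinearEquiv.ofLinearMap f g ?_ ?_⟩
  · apply (torsionHomEquiv hN).injective
    ext n
    rw [coe_torsionHomEquiv, coe_torsionHomEquiv, LinearMap.comp_apply, hg, hf,
      e.apply_symm_apply]
    rfl
  · apply (torsionHomEquiv hM).injective
    ext m
    rw [coe_torsionHomEquiv, coe_torsionHomEquiv, LinearMap.comp_apply, hf, hg,
      e.symm_apply_apply]
    rfl

/-- Torsion modules are projective: a linear lift on the kernel of `x` extends. -/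
theorem IsXTorsion.projective (hM : IsXTorsion K M) : Module.Projective (ToeplitzAlgebra K) M := by
  refine Module.Projective.of_lifting_property'' fun f hf => ?_
  have hsurj : Function.Surjective (kerXRestrict (K := K) _ M f) := by
    intro m
    obtain ⟨v, hv⟩ := hf m
    refine ⟨kerXProj K _ v, Subtype.ext ?_⟩
    rw [coe_kerXRestrict, coe_kerXProj, map_smul, hv]
    exact idem_smul_of_x_smul_eq_zero m.2
  obtain ⟨s, hs⟩ := (kerXRestrict (K := K) _ M f).exists_rightInverse_of_surjective
    (LinearMap.range_eq_top.mpr hsurj)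
  refine ⟨(torsionHomEquiv hM).symm s, (torsionHomEquiv hM).injective ?_⟩
  ext m
  have h1 := coe_torsionHomEquiv hM ((torsionHomEquiv hM).symm s) m
  rw [LinearEquiv.apply_symm_apply] at h1
  rw [coe_torsionHomEquiv, coe_torsionHomEquiv, LinearMap.comp_apply, ← h1, ← coe_kerXRestrict]
  exact congrArg Subtype.val (LinearMap.congr_fun hs m)

end KerX

end Modules

section Torsion

variable {K : Type u} [Field K] {M N : Type u} [AddCommGroup M] [Module K M]
  [Module (ToeplitzAlgebra K) M] [IsScalarTower K (ToeplitzAlgebra K) M] [AddCommGroup N]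
  [Module K N] [Module (ToeplitzAlgebra K) N] [IsScalarTower K (ToeplitzAlgebra K) N]

/-- Submodules of a torsion module correspond to subspaces of the kernel of `x`. The inverse sends
`W` to the set of all `m` with `(1 - y x) xʲ m ∈ W` for all `j`. -/
def torsionSubmoduleOrderIso (hM : IsXTorsion K M) :
    Submodule (ToeplitzAlgebra K) M ≃o Submodule K (kerX K M) :=
  let c (j : ℕ) : M →ₗ[K] kerX K M := kerXProj K M ∘ₗ Module.toModuleEnd K M (x K ^ j)
  have hc (j : ℕ) (m : M) : c j m = kerXProj K M (x K ^ j • m) := rfl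
  have hcx (j : ℕ) (m : M) : c j (x K • m) = c (j + 1) m := by
    rw [hc, hc, pow_succ, mul_smul]
  have hcy (j : ℕ) (m : M) : c (j + 1) (y K • m) = c j m := by
    rw [hc, hc, x_pow_succ_smul_y_smul]
  have hcy0 (m : M) : c 0 (y K • m) = 0 := Subtype.ext (by
    rw [hc, coe_kerXProj, pow_zero, one_smul, idem_smul_y_smul]; rfl)
  have hck (j : ℕ) (m : kerX K M) : c (j + 1) m = 0 := by
    rw [hc, pow_succ, mul_smul, mem_kerX.mp m.2, smul_zero, map_zero]
  have hck0 (m : kerX K M) : c 0 m = m := by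
    rw [hc, pow_zero, one_smul, kerXProj_coe]
  let e : Submodule (ToeplitzAlgebra K) M ≃ Submodule K (kerX K M) :=
    { toFun U := (U.restrictScalars K).comap (kerX K M).subtype
      invFun W :=
        { (⨅ j, W.comap (c j) : Submodule K M) with
          smul_mem' := (isGradedPair K).smul_mem (⨅ j, W.comap (c j))
            (fun m hm => by
              rw [Submodule.mem_iInf] at hm ⊢
              intro j
              rw [Submodule.mem_comap, hcx]
              exact hm (j + 1))
            (fun m hm => by
              rw [Submodule.mem_iInf] at hm ⊢
              intro j
              rw [Submodule.mem_comap]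
              cases j with
              | zero => rw [hcy0]; exact zero_mem _
              | succ j => rw [hcy]; exact hm j) }
      left_inv U := by
        ext m
        change m ∈ (⨅ j, Submodule.comap (c j) _ : Submodule K M) ↔ m ∈ U
        simp only [Submodule.mem_iInf, Submodule.mem_comap, Submodule.subtype_apply,
          Submodule.restrictScalars_mem, hc, coe_kerXProj]
        constructor
        · induction m using hM.induction with
          | zero => exact fun _ => zero_mem _
          | step m ih =>
            intro hm
            rw [← idem_smul_add (K := K) m]
            refine add_mem (by simpa using hm 0) (U.smul_mem _ (ih fun j => ?_))
            rw [← mul_smul (x K ^ j), ← pow_succ]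
            exact hm (j + 1)
        · exact fun hm j => U.smul_mem _ (U.smul_mem _ hm)
      right_inv W := by
        ext m
        change (m : M) ∈ (⨅ j, Submodule.comap (c j) _ : Submodule K M) ↔ m ∈ W
        simp only [Submodule.mem_iInf, Submodule.mem_comap]
        constructor
        · intro h
          simpa only [hck0] using h 0
        · intro h j
          cases j with
          | zero => rwa [hck0]
          | succ j => rw [hck]; exact zero_mem _ }
  e.toOrderIso (fun _ _ h => Submodule.comap_mono h)
    fun _ _ h => iInf_mono fun _ => Submodule.comap_mono h

theorem mem_torsionSubmoduleOrderIso (hM : IsXTorsion K M)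
    (U : Submodule (ToeplitzAlgebra K) M) (m : kerX K M) :
    m ∈ torsionSubmoduleOrderIso hM U ↔ (m : M) ∈ U := Iff.rfl

theorem length_eq_length_kerX (hM : IsXTorsion K M) :
    Module.length (ToeplitzAlgebra K) M = Module.length K (kerX K M) := by
  have h := Order.krullDim_eq_of_orderIso (torsionSubmoduleOrderIso hM)
  rw [← Module.coe_length, ← Module.coe_length] at h
  exact_mod_cast h

theorem IsXTorsion.finiteDimensional_kerX (hM : IsXTorsion K M)
    [IsNoetherian (ToeplitzAlgebra K) M] [IsArtinian (ToeplitzAlgebra K) M] :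
    FiniteDimensional K (kerX K M) := by
  have h := Module.length_ne_top (R := ToeplitzAlgebra K) (M := M)
  rw [length_eq_length_kerX hM, Module.length_ne_top_iff,
    isFiniteLength_iff_isNoetherian_isArtinian] at h
  have := h.1
  infer_instance

theorem len_eq_finrank_kerX (hM : IsXTorsion K M)
    [IsNoetherian (ToeplitzAlgebra K) M] [IsArtinian (ToeplitzAlgebra K) M] :
    len (ToeplitzAlgebra K) M = Module.finrank K (kerX K M) := by
  have := hM.finiteDimensional_kerX
  rw [len, length_eq_length_kerX hM, Module.length_eq_finrank, ENat.toNat_natCast]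

variable (K N) in
/-- The kernel of `x` lies in `I N`. -/
def kerXIMEquiv : kerX K (IM K N) ≃ₗ[K] kerX K N where
  toFun n := ⟨(n : IM K N), congrArg Subtype.val n.2⟩
  invFun n := ⟨⟨n, mem_IM_iff.mpr ⟨1, by rw [pow_one]; exact n.2⟩⟩, Subtype.ext n.2⟩
  left_inv _ := rfl
  right_inv _ := rfl
  map_add' _ _ := rfl
  map_smul' _ _ := rfl

theorem finrank_kerX_eq_len [IsNoetherian (ToeplitzAlgebra K) N]
    [IsArtinian (ToeplitzAlgebra K) N] :
    Module.finrank K (kerX K N) = len (ToeplitzAlgebra K) (IM K N) := by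
  rw [len_eq_finrank_kerX (isXTorsion_IM K N), (kerXIMEquiv K N).finrank_eq]

variable (K N) in
theorem finiteDimensional_kerX [IsNoetherian (ToeplitzAlgebra K) N]
    [IsArtinian (ToeplitzAlgebra K) N] : FiniteDimensional K (kerX K N) :=
  have := (isXTorsion_IM K N).finiteDimensional_kerX
  Module.Finite.equiv (kerXIMEquiv K N)

theorem finrank_torsionHom (hM : IsXTorsion K M) [IsNoetherian (ToeplitzAlgebra K) M]
    [IsArtinian (ToeplitzAlgebra K) M] [IsNoetherian (ToeplitzAlgebra K) N]
    [IsArtinian (ToeplitzAlgebra K) N] :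
    FiniteDimensional K (M →ₗ[ToeplitzAlgebra K] N) ∧
      Module.finrank K (M →ₗ[ToeplitzAlgebra K] N) =
        Module.finrank K (kerX K M) * Module.finrank K (kerX K N) := by
  have := hM.finiteDimensional_kerX
  have := finiteDimensional_kerX K N
  refine ⟨Module.Finite.equiv (torsionHomEquiv hM).symm, ?_⟩
  rw [(torsionHomEquiv hM).finrank_eq, Module.finrank_linearMap]

/-- A homomorphism into a torsion module is determined on the kernel of `x`. -/
theorem kerXRestrict_injective_of_target (hN : IsXTorsion K N) :
    Function.Injective (kerXRestrict (K := K) M N) := by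
  rw [← LinearMap.ker_eq_bot, LinearMap.ker_eq_bot']
  intro ψ hψ
  have key (n : N) : ∀ m, ψ m = n → n = 0 := by
    induction n using hN.induction with
    | zero => exact fun _ _ => rfl
    | step n ih =>
      rintro m rfl
      have h0 := congrArg Subtype.val (LinearMap.congr_fun hψ (kerXProj K M m))
      rw [coe_kerXRestrict, coe_kerXProj] at h0
      have h1 : ψ (x K • m) = 0 := by
        rw [map_smul]
        exact ih (x K • m) (map_smul ψ (x K) m)
      rw [← idem_smul_add (K := K) m, map_add, h0, map_smul ψ (y K), h1]
      simp
  ext m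
  exact key _ m rfl

theorem hom_eq_zero_of_killedByI [KilledByI K M] (hN : IsXTorsion K N)
    (ψ : M →ₗ[ToeplitzAlgebra K] N) : ψ = 0 := by
  apply kerXRestrict_injective_of_target (K := K) hN
  ext m
  have : m = 0 := Subtype.ext (eq_zero_of_x_smul_eq_zero m.2)
  rw [this, map_zero, map_zero]

end Torsion

/-! ### The simple projective module `S` -/

section Simple

variable (K : Type u) [Field K]

/-- The idempotent `1 - y x` is nonzero: it acts as the projection to the first coordinate in the
representation of `x` and `y` by the two shifts of sequences. -/
theorem idem_ne_zero : 1 - y K * x K ≠ 0 := by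
  let X : Module.End K (ℕ → K) :=
    { toFun f n := f (n + 1)
      map_add' _ _ := rfl
      map_smul' _ _ := rfl }
  let Y : Module.End K (ℕ → K) :=
    { toFun f n := n.casesOn 0 f
      map_add' f g := by ext n; cases n <;> simp
      map_smul' c f := by ext n; cases n <;> simp }
  let ρ₀ : FreeAlgebra K (Fin 2) →ₐ[K] Module.End K (ℕ → K) := FreeAlgebra.lift K ![X, Y]
  let ρ : ToeplitzAlgebra K →ₐ[K] Module.End K (ℕ → K) :=
    RingQuot.liftAlgHom K ⟨ρ₀, fun a b hab => by
      obtain ⟨⟩ := hab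
      simp only [map_mul, map_one, ρ₀, FreeAlgebra.lift_ι_apply]
      rfl⟩
  have hx : ρ (x K) = X := by
    refine (RingQuot.liftAlgHom_mkAlgHom_apply K (s := ToeplitzRel K) ρ₀ _ _).trans ?_
    simp [ρ₀]
  have hy : ρ (y K) = Y := by
    refine (RingQuot.liftAlgHom_mkAlgHom_apply K (s := ToeplitzRel K) ρ₀ _ _).trans ?_
    simp [ρ₀]
  intro h
  have h1 : ρ (1 - y K * x K) = 0 := by rw [h]; exact map_zero ρ
  have h2 : ρ (1 - y K * x K) = 1 - Y * X := by
    rw [← hx, ← hy, ← map_mul, ← map_one ρ]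
    exact map_sub ρ _ _
  rw [h2] at h1
  have h3 := congrFun (LinearMap.congr_fun h1 fun _ => 1) 0
  simp [X, Y] at h3

theorem isXTorsion_S : IsXTorsion K (S K) := by
  have hS : S K ≤ IM K (ToeplitzAlgebra K) := by
    rw [S, Submodule.span_le, Set.singleton_subset_iff]
    have := idem_smul_mem_IM (K := K) (1 : ToeplitzAlgebra K)
    rwa [smul_eq_mul, mul_one] at this
  intro s
  obtain ⟨k, hk⟩ := mem_IM_iff.mp (hS s.2)
  exact ⟨k, Subtype.ext hk⟩

theorem finrank_kerX_S : Module.finrank K (kerX K (S K)) = 1 := by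
  have hx : x K * (1 - y K * x K) = 0 := by
    rw [mul_sub, mul_one, ← mul_assoc, x_mul_y, one_mul, sub_self]
  let s : S K := ⟨1 - y K * x K, Submodule.mem_span_singleton_self _⟩
  let e : kerX K (S K) := ⟨s, Subtype.ext hx⟩
  have he : e ≠ 0 := fun h => idem_ne_zero K (congrArg (fun v : kerX K (S K) => ((v : S K) : ToeplitzAlgebra K)) h)
  have hW : (torsionSubmoduleOrderIso (isXTorsion_S K)).symm (K ∙ e) = ⊤ := by
    have hs : s ∈ (torsionSubmoduleOrderIso (isXTorsion_S K)).symm (K ∙ e) := by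
      change (e : S K) ∈ _
      rw [← mem_torsionSubmoduleOrderIso (isXTorsion_S K), OrderIso.apply_symm_apply]
      exact Submodule.mem_span_singleton_self e
    rw [eq_top_iff]
    rintro ⟨t, ht⟩ -
    obtain ⟨r, rfl⟩ := Submodule.mem_span_singleton.mp ht
    exact Submodule.smul_mem _ r hs
  have htop : (K ∙ e) = ⊤ := by
    rw [← OrderIso.apply_symm_apply (torsionSubmoduleOrderIso (isXTorsion_S K)) (K ∙ e), hW,
      OrderIso.map_top]
  rw [← finrank_top, ← htop, finrank_span_singleton he]

instance finiteDimensional_kerX_S : FiniteDimensional K (kerX K (S K)) :=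
  Module.finite_of_finrank_eq_succ (finrank_kerX_S K)

variable {K}

theorem isXTorsion_pi {n : ℕ} {N : Type u} [AddCommGroup N] [Module (ToeplitzAlgebra K) N]
    (hN : IsXTorsion K N) : IsXTorsion K (Fin n → N) := by
  intro s
  choose b hb using fun i => hN (s i)
  exact ⟨Finset.univ.sup b, funext fun i =>
    x_pow_smul_eq_zero_of_le (Finset.le_sup (Finset.mem_univ i)) (hb i)⟩

/-- The kernel of `x` on a power. -/
def kerXPiEquiv (n : ℕ) (N : Type u) [AddCommGroup N] [Module K N] [Module (ToeplitzAlgebra K) N]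
    [IsScalarTower K (ToeplitzAlgebra K) N] : kerX K (Fin n → N) ≃ₗ[K] (Fin n → kerX K N) where
  toFun s i := ⟨s.1 i, congrFun s.2 i⟩
  invFun s := ⟨fun i => s i, funext fun i => (s i).2⟩
  left_inv _ := rfl
  right_inv _ := rfl
  map_add' _ _ := rfl
  map_smul' _ _ := rfl

instance (n : ℕ) : FiniteDimensional K (kerX K (Fin n → S K)) :=
  Module.Finite.equiv (kerXPiEquiv n (S K)).symm

theorem finrank_kerX_pi_S (n : ℕ) : Module.finrank K (kerX K (Fin n → S K)) = n := by
  rw [(kerXPiEquiv n (S K)).finrank_eq, Module.finrank_pi_fintype]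
  simp [finrank_kerX_S]

variable {M N : Type u} [AddCommGroup M] [Module K M] [Module (ToeplitzAlgebra K) M]
  [IsScalarTower K (ToeplitzAlgebra K) M] [AddCommGroup N] [Module K N]
  [Module (ToeplitzAlgebra K) N] [IsScalarTower K (ToeplitzAlgebra K) N]

theorem IsXTorsion.nonempty_linearEquiv_pi_S (hN : IsXTorsion K N)
    [FiniteDimensional K (kerX K N)] :
    Nonempty (N ≃ₗ[ToeplitzAlgebra K] (Fin (Module.finrank K (kerX K N)) → S K)) :=
  hN.nonempty_linearEquiv (isXTorsion_pi (isXTorsion_S K))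
    (LinearEquiv.ofFinrankEq _ _ (finrank_kerX_pi_S _).symm)

theorem finrank_hom_S_of_isXTorsion (hN : IsXTorsion K N) [FiniteDimensional K (kerX K N)] :
    FiniteDimensional K (N →ₗ[ToeplitzAlgebra K] S K) ∧
      Module.finrank K (N →ₗ[ToeplitzAlgebra K] S K) = Module.finrank K (kerX K N) := by
  refine ⟨Module.Finite.equiv (torsionHomEquiv hN).symm, ?_⟩
  rw [(torsionHomEquiv hN).finrank_eq, Module.finrank_linearMap, finrank_kerX_S, mul_one]

theorem finiteDimensional_hom_of_isXTorsion (hN : IsXTorsion K N) [FiniteDimensional K (kerX K M)]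
    [FiniteDimensional K (kerX K N)] : FiniteDimensional K (M →ₗ[ToeplitzAlgebra K] N) :=
  Module.Finite.of_injective _ (kerXRestrict_injective_of_target hN)

/-- The number `d(M)` is the dimension of `Hom(M, S)`. The image `U` of `M` under a basis of
`Hom(M, S)` is a torsion module with `Hom(U, S) = Hom(M, S)`; it is isomorphic to a power of `S` and
projective, hence a direct summand of `M`. -/
theorem isGreatest_summandMultiplicities [IsNoetherian (ToeplitzAlgebra K) M]
    [IsArtinian (ToeplitzAlgebra K) M] :
    IsGreatest (summandMultiplicities K M) (Module.finrank K (M →ₗ[ToeplitzAlgebra K] S K)) := by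
  have := finiteDimensional_kerX K M
  have : FiniteDimensional K (M →ₗ[ToeplitzAlgebra K] S K) :=
    finiteDimensional_hom_of_isXTorsion (isXTorsion_S K)
  constructor
  · let b := Module.finBasis K (M →ₗ[ToeplitzAlgebra K] S K)
    let Φ := LinearMap.pi (R := ToeplitzAlgebra K) b
    let U := LinearMap.range Φ
    let π : M →ₗ[ToeplitzAlgebra K] U := Φ.rangeRestrict
    have hπ : Function.Surjective π := Φ.surjective_rangeRestrict
    have hU : IsXTorsion K U := fun u => by
      obtain ⟨k, hk⟩ := isXTorsion_pi (isXTorsion_S K) u.1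
      exact ⟨k, Subtype.ext hk⟩
    have : IsNoetherian (ToeplitzAlgebra K) U := isNoetherian_of_surjective π (LinearMap.range_eq_top.mpr hπ)
    have : IsArtinian (ToeplitzAlgebra K) U := isArtinian_of_surjective M π hπ
    have := hU.finiteDimensional_kerX
    have hfin : Module.finrank K (kerX K U) =
        Module.finrank K (M →ₗ[ToeplitzAlgebra K] S K) := by
      rw [← (finrank_hom_S_of_isXTorsion hU).2]
      let c : (U →ₗ[ToeplitzAlgebra K] S K) →ₗ[K] (M →ₗ[ToeplitzAlgebra K] S K) :=
        { toFun f := f ∘ₗ π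
          map_add' _ _ := rfl
          map_smul' _ _ := rfl }
      refine (LinearEquiv.ofBijective c ⟨fun f g h => ?_, ?_⟩).finrank_eq
      · exact (LinearMap.cancel_right hπ).mp h
      · rw [← LinearMap.range_eq_top, eq_top_iff, ← b.span_eq, Submodule.span_le]
        rintro _ ⟨i, rfl⟩
        exact ⟨LinearMap.proj i ∘ₗ U.subtype, rfl⟩
    have := hU.projective
    obtain ⟨σ, hσ⟩ := Module.projective_lifting_property π LinearMap.id hπ
    have hσ' (u : U) : π (σ u) = u := LinearMap.congr_fun hσ u
    have hinj : Function.Injective σ := fun u v h => by rw [← hσ' u, h, hσ']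
    refine ⟨LinearMap.range σ, LinearMap.ker π, ⟨?_, ?_⟩, ?_⟩
    · rw [Submodule.disjoint_def]
      rintro _ ⟨u, rfl⟩ hu
      rw [LinearMap.mem_ker, hσ'] at hu
      rw [hu, map_zero]
    · rw [codisjoint_iff, eq_top_iff]
      intro m _
      refine Submodule.mem_sup.mpr ⟨σ (π m), ⟨_, rfl⟩, m - σ (π m), ?_, by abel⟩
      rw [LinearMap.mem_ker, map_sub, hσ', sub_self]
    · obtain ⟨e⟩ := hU.nonempty_linearEquiv_pi_S
      rw [hfin] at e
      exact ⟨(LinearEquiv.ofInjective σ hinj).symm ≪≫ₗ e⟩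
  · rintro n ⟨P, Q, hPQ, ⟨e⟩⟩
    let π : M →ₗ[ToeplitzAlgebra K] (Fin n → S K) :=
      e.toLinearMap ∘ₗ P.projectionOnto Q hPQ
    have hπ : Function.Surjective π :=
      e.surjective.comp (Submodule.projectionOnto_surjective hPQ)
    let c : ((Fin n → S K) →ₗ[ToeplitzAlgebra K] S K) →ₗ[K] (M →ₗ[ToeplitzAlgebra K] S K) :=
      { toFun f := f ∘ₗ π
        map_add' _ _ := rfl
        map_smul' _ _ := rfl }
    have hc : Function.Injective c := fun f g h => (LinearMap.cancel_right hπ).mp h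
    have := LinearMap.finrank_le_finrank_of_injective hc
    rwa [(finrank_hom_S_of_isXTorsion (isXTorsion_pi (isXTorsion_S K))).2,
      finrank_kerX_pi_S] at this

theorem d_eq_finrank_hom [IsNoetherian (ToeplitzAlgebra K) M]
    [IsArtinian (ToeplitzAlgebra K) M] :
    d K M = Module.finrank K (M →ₗ[ToeplitzAlgebra K] S K) :=
  isGreatest_summandMultiplicities.csSup_eq

theorem finrank_hom_of_isXTorsion [IsNoetherian (ToeplitzAlgebra K) M]
    [IsArtinian (ToeplitzAlgebra K) M] (hN : IsXTorsion K N) [FiniteDimensional K (kerX K N)] :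
    Module.finrank K (M →ₗ[ToeplitzAlgebra K] N) = d K M * Module.finrank K (kerX K N) := by
  have := finiteDimensional_kerX K M
  have : FiniteDimensional K (M →ₗ[ToeplitzAlgebra K] S K) :=
    finiteDimensional_hom_of_isXTorsion (isXTorsion_S K)
  obtain ⟨e⟩ := hN.nonempty_linearEquiv_pi_S
  let c : (M →ₗ[ToeplitzAlgebra K] N) ≃ₗ[K]
      (M →ₗ[ToeplitzAlgebra K] (Fin (Module.finrank K (kerX K N)) → S K)) :=
    { toFun f := e.toLinearMap ∘ₗ f
      invFun f := e.symm.toLinearMap ∘ₗ f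
      left_inv f := by ext m; simp
      right_inv f := by ext m; simp
      map_add' f g := by ext m; simp
      map_smul' r f := by
        refine LinearMap.ext fun m => ?_
        change e (r • f m) = r • e (f m)
        rw [← algebraMap_smul (ToeplitzAlgebra K) r (f m), map_smul, algebraMap_smul] }
  rw [c.finrank_eq, ← (LinearEquiv.linearMapPi K).finrank_eq, Module.finrank_pi_fintype,
    d_eq_finrank_hom]
  simp [mul_comm]

end Simple

variable {K : Type u} [Field K]

/-! ### Modules killed by `I` -/

section Killed

variable {V W : Type u} [AddCommGroup V] [Module K V] [Module (ToeplitzAlgebra K) V]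
  [IsScalarTower K (ToeplitzAlgebra K) V] [AddCommGroup W] [Module K W]
  [Module (ToeplitzAlgebra K) W] [IsScalarTower K (ToeplitzAlgebra K) W]

/-- Between modules killed by `I`, linearity over the Toeplitz algebra and over the Laurent
polynomials agree. -/
def laurentHomEquiv [KilledByI K V] [KilledByI K W] :
    (V →ₗ[ToeplitzAlgebra K] W) ≃ₗ[K] (V →ₗ[K[T;T⁻¹]] W) where
  toFun f := { f with
    map_smul' := (isGradedPair_laurent K).map_smul (f.restrictScalars K)
      (fun v => by simp [T_one_smul]) (fun v => by simp [T_neg_one_smul]) }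
  invFun f := { f with
    map_smul' := (isGradedPair K).map_smul (f.restrictScalars K)
      (fun v => by simp [← T_one_smul]) (fun v => by simp [← T_neg_one_smul]) }
  left_inv _ := rfl
  right_inv _ := rfl
  map_add' _ _ := rfl
  map_smul' _ _ := rfl

/-- Both rings give the same complex `φ ↦ y φ - φ y` computing `Ext¹`. -/
theorem nonempty_ext1_equiv_laurent [KilledByI K V] [KilledByI K W] :
    Nonempty (Ext1 (ToeplitzAlgebra K) V W ≃ₗ[K] Ext1 K[T;T⁻¹] V W) := by
  have hy : Function.Bijective fun v : V => y K • v := y_smul_bijective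
  obtain ⟨e⟩ := nonempty_ext_equiv_commutatorMap V W (isGradedPair K) hy
  obtain ⟨e'⟩ := nonempty_ext_equiv_commutatorMap V W (isGradedPair_laurent K)
    (by simpa only [T_neg_one_smul] using hy)
  have h : commutatorMap K (y K) V W =
      commutatorMap K (LaurentPolynomial.T (-1) : K[T;T⁻¹]) V W := by
    ext φ v
    simp [T_neg_one_smul]
  exact ⟨e ≪≫ₗ Submodule.quotEquivOfEq _ _ (by rw [h]) ≪≫ₗ e'.symm⟩

theorem finiteDimensional_ext1_of_killedByI [KilledByI K V] [FiniteDimensional K V]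
    [FiniteDimensional K W] : FiniteDimensional K (Ext1 (ToeplitzAlgebra K) V W) := by
  obtain ⟨e⟩ := nonempty_ext_equiv_commutatorMap V W (isGradedPair K) y_smul_bijective
  exact Module.Finite.equiv e.symm

/-- A simple module killed by `I` is a simple module over the Laurent polynomials, hence
finite-dimensional by Zariski's lemma. -/
theorem finiteDimensional_of_isSimpleModule [KilledByI K V]
    [IsSimpleModule (ToeplitzAlgebra K) V] : FiniteDimensional K V := by
  have hs : IsSimpleModule K[T;T⁻¹] V := by
    rw [isSimpleModule_iff_toSpanSingleton_surjective]
    refine ⟨IsSimpleModule.nontrivial (ToeplitzAlgebra K) V, fun v hv => ?_⟩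
    let U₀ : Submodule K V :=
      (LinearMap.range (LinearMap.toSpanSingleton K[T;T⁻¹] V v)).restrictScalars K
    have hU₀ (p : K[T;T⁻¹]) (u : V) (hu : u ∈ U₀) : p • u ∈ U₀ :=
      Submodule.smul_mem (LinearMap.range (LinearMap.toSpanSingleton K[T;T⁻¹] V v)) p hu
    let U : Submodule (ToeplitzAlgebra K) V :=
      { U₀ with
        smul_mem' := (isGradedPair K).smul_mem U₀
          (fun u hu => by rw [← T_one_smul]; exact hU₀ _ u hu)
          (fun u hu => by rw [← T_neg_one_smul]; exact hU₀ _ u hu) }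
    have hvU : v ∈ U := ⟨1, by simp⟩
    have hU : U = ⊤ := (eq_bot_or_eq_top U).resolve_left fun h => hv (by simpa [h] using hvU)
    intro w
    have hw : w ∈ U := by rw [hU]; trivial
    exact hw
  obtain ⟨J, hJ, ⟨e⟩⟩ := isSimpleModule_iff_quot_maximal.mp hs
  let _ : Field (K[T;T⁻¹] ⧸ J) := Ideal.Quotient.field J
  have : Algebra.FiniteType K (K[T;T⁻¹] ⧸ J) :=
    Algebra.FiniteType.of_surjective (Ideal.Quotient.mkₐ K J) (Ideal.Quotient.mkₐ_surjective K J)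
  have := finite_of_finite_type_of_isJacobsonRing K (K[T;T⁻¹] ⧸ J)
  exact Module.Finite.equiv (e.restrictScalars K).symm

theorem finiteDimensional_of_isFiniteLength {M : Type u} [AddCommGroup M]
    [Module (ToeplitzAlgebra K) M] (h : IsFiniteLength (ToeplitzAlgebra K) M) :
    ∀ [Module K M] [IsScalarTower K (ToeplitzAlgebra K) M] [KilledByI K M],
      FiniteDimensional K M := by
  induction h with
  | of_subsingleton => intros; infer_instance
  | @of_simple_quotient M _ _ U _ hU ih =>
    intro _ _ hM
    have hUk : KilledByI K U := ⟨fun a ha u => Subtype.ext (hM.smul_eq_zero a ha u)⟩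
    have hQk : KilledByI K (M ⧸ U) := ⟨fun a ha v => by
      obtain ⟨v, rfl⟩ := Submodule.Quotient.mk_surjective _ v
      rw [← Submodule.Quotient.mk_smul, hM.smul_eq_zero a ha v, Submodule.Quotient.mk_zero]⟩
    have : FiniteDimensional K (U.restrictScalars K) := ih
    have : FiniteDimensional K (M ⧸ U) := finiteDimensional_of_isSimpleModule
    have : FiniteDimensional K (M ⧸ U.restrictScalars K) :=
      Module.Finite.equiv (Submodule.Quotient.restrictScalarsEquiv K U).symm
    exact Module.Finite.of_submodule_quotient (U.restrictScalars K)

variable (V W) in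
/-- Homomorphisms to a module killed by `I` factor through `V / I V`. -/
def quotientHomEquiv [KilledByI K W] :
    ((V ⧸ IM K V) →ₗ[ToeplitzAlgebra K] W) ≃ₗ[K] (V →ₗ[ToeplitzAlgebra K] W) where
  toFun f := f ∘ₗ (IM K V).mkQ
  invFun f := (IM K V).liftQ f <| Submodule.smul_le.mpr fun a ha v _ => by
    rw [LinearMap.mem_ker, map_smul]
    exact KilledByI.smul_eq_zero a (by simpa using ha) _
  left_inv f := by ext; rfl
  right_inv f := by ext; rfl
  map_add' _ _ := rfl
  map_smul' _ _ := rfl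

end Killed

/-! ### The locally finite part -/

section LocallyFinite

variable (K) (N : Type u) [AddCommGroup N] [Module K N] [Module (ToeplitzAlgebra K) N]
  [IsScalarTower K (ToeplitzAlgebra K) N]

/-- The locally finite part meets `I N` trivially, so it embeds into `N / I N`. -/
theorem finiteDimensional_lf [FiniteDimensional K (N ⧸ IM K N)] :
    FiniteDimensional K (lf K N) := by
  let f : lf K N →ₗ[K] N ⧸ IM K N := ((IM K N).mkQ ∘ₗ (lf K N).subtype).restrictScalars K
  refine Module.Finite.of_injective f (LinearMap.ker_eq_bot.mp ?_)
  rw [LinearMap.ker_eq_bot']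
  intro n hn
  have hn' : (n : N) ∈ IM K N := (Submodule.Quotient.mk_eq_zero _).mp hn
  obtain ⟨k, hk⟩ := mem_IM_iff.mp hn'
  have : n ∈ IM K (lf K N) := mem_IM_iff.mpr ⟨k, Subtype.ext hk⟩
  rwa [IM_eq_bot, Submodule.mem_bot] at this

variable (F : Type u) [AddCommGroup F] [Module K F] [Module (ToeplitzAlgebra K) F]
  [IsScalarTower K (ToeplitzAlgebra K) F] [FiniteDimensional K F]

/-- A homomorphism from a finite-dimensional module takes values in the locally finite part. -/
def lfHomEquiv : (F →ₗ[ToeplitzAlgebra K] lf K N) ≃ₗ[K] (F →ₗ[ToeplitzAlgebra K] N) where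
  toFun f := (lf K N).subtype ∘ₗ f
  invFun f := f.codRestrict (lf K N) fun v => by
    have : FiniteDimensional K (LinearMap.range f) :=
      inferInstanceAs (FiniteDimensional K (LinearMap.range (f.restrictScalars K)))
    exact le_sSup (a := LinearMap.range f) this ⟨v, rfl⟩
  left_inv _ := rfl
  right_inv _ := rfl
  map_add' _ _ := rfl
  map_smul' _ _ := rfl

end LocallyFinite

/-! ### Extensions of finite-dimensional modules by torsion modules -/

section ExtTorsion

variable {F N : Type u} [AddCommGroup F] [Module K F] [FiniteDimensional K F] [AddCommGroup N]
  [Module K N] [Module (ToeplitzAlgebra K) N] [IsScalarTower K (ToeplitzAlgebra K) N]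

theorem exists_x_pow_smul_apply_eq_zero (hN : IsXTorsion K N) (φ : F →ₗ[K] N) :
    ∃ k : ℕ, ∀ v, x K ^ k • φ v = 0 := by
  let b := Module.finBasis K F
  choose c hc using fun i => hN (φ (b i))
  refine ⟨Finset.univ.sup c, fun v => ?_⟩
  have : Module.toModuleEnd K N (x K ^ Finset.univ.sup c) ∘ₗ φ = 0 := b.ext fun i =>
    x_pow_smul_eq_zero_of_le (Finset.le_sup (Finset.mem_univ i)) (hc i)
  exact LinearMap.congr_fun this v

variable [Module (ToeplitzAlgebra K) F] [IsScalarTower K (ToeplitzAlgebra K) F]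

/-- For torsion `N`, every linear map `F → N` is congruent modulo the maps `y φ - φ y` to a unique
linear map into the kernel of `x`. For existence,
`φ = (1 - y x) φ + y (x φ) ≡ (1 - y x) φ + x φ y`, and `φ ↦ x φ y` is locally nilpotent. For
uniqueness, if `x (y φ - φ y) = 0` then `φ = x φ y = x² φ y² = ⋯ = 0`. -/
theorem nonempty_ext1_equiv_of_isXTorsion (hN : IsXTorsion K N) :
    Nonempty (Ext1 (ToeplitzAlgebra K) F N ≃ₗ[K] (F →ₗ[K] kerX K N)) := by
  obtain ⟨e⟩ := nonempty_ext_equiv_commutatorMap F N (isGradedPair K) y_smul_bijective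
  let D := commutatorMap K (y K) F N
  let ι : (F →ₗ[K] kerX K N) →ₗ[K] (F →ₗ[K] N) ⧸ LinearMap.range D :=
    (LinearMap.range D).mkQ ∘ₗ LinearMap.compRight K (kerX K N).subtype
  have hι (ψ : F →ₗ[K] kerX K N) :
      ι ψ = Submodule.Quotient.mk ((kerX K N).subtype ∘ₗ ψ) := rfl
  have hinj : Function.Injective ι := by
    rw [← LinearMap.ker_eq_bot, LinearMap.ker_eq_bot']
    intro ψ hψ
    rw [hι, Submodule.Quotient.mk_eq_zero] at hψ
    obtain ⟨φ, hφ⟩ := hψ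
    have hφv (v : F) : y K • φ v - φ (y K • v) = ψ v := LinearMap.congr_fun hφ v
    have hrec (v : F) : φ v = x K • φ (y K • v) := by
      have := congrArg (fun n => x K • n) (hφv v)
      simp only [smul_sub, x_smul_y_smul] at this
      rw [mem_kerX.mp (ψ v).2] at this
      exact sub_eq_zero.mp this
    have hzero : ∀ v, φ v = 0 := by
      obtain ⟨k, hk⟩ := exists_x_pow_smul_apply_eq_zero hN φ
      induction k with
      | zero => simpa using hk
      | succ k ih =>
        refine ih fun v => ?_
        rw [hrec, ← mul_smul, ← pow_succ]
        exact hk _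
    ext v
    rw [← hφv, hzero, hzero]
    simp
  have hsurj : Function.Surjective ι := by
    intro q
    obtain ⟨φ, rfl⟩ := Submodule.Quotient.mk_surjective _ q
    obtain ⟨k, hk⟩ := exists_x_pow_smul_apply_eq_zero hN φ
    induction k generalizing φ with
    | zero =>
      refine ⟨0, ?_⟩
      have : φ = 0 := by ext v; simpa using hk v
      rw [map_zero, this, Submodule.Quotient.mk_zero]
    | succ k ih =>
      let X : Module.End K N := Module.toModuleEnd K N (x K)
      obtain ⟨ψ, hψ⟩ := ih (X ∘ₗ φ ∘ₗ Module.toModuleEnd K F (y K)) fun v => by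
        change x K ^ k • x K • φ (y K • v) = 0
        rw [← mul_smul, ← pow_succ]
        exact hk _
      refine ⟨kerXProj K N ∘ₗ φ + ψ, ?_⟩
      rw [map_add, hψ, hι, ← Submodule.Quotient.mk_add, eq_comm, Submodule.Quotient.eq]
      refine ⟨X ∘ₗ φ, ?_⟩
      ext v
      change y K • x K • φ v - x K • φ (y K • v) =
        φ v - ((1 - y K * x K) • φ v + x K • φ (y K • v))
      rw [idem_smul]
      abel
  exact ⟨e ≪≫ₗ (LinearEquiv.ofBijective ι ⟨hinj, hsurj⟩).symm⟩

end ExtTorsion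

/-! ### The long exact sequences of `I M ⊆ M` -/

section FiniteLength

variable {M N : Type u} [AddCommGroup M] [Module K M]
  [Module (ToeplitzAlgebra K) M] [IsScalarTower K (ToeplitzAlgebra K) M] [AddCommGroup N]
  [Module K N] [Module (ToeplitzAlgebra K) N] [IsScalarTower K (ToeplitzAlgebra K) N]

/-- Finite length is not needed: `I M` is projective and `M / I M` has the length-one resolution. -/
theorem subsingleton_ext_two_toeplitz {W : Type u} [AddCommGroup W]
    [Module (ToeplitzAlgebra K) W] :
    Subsingleton (Abelian.Ext.{u} (ModuleCat.of (ToeplitzAlgebra K) M)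
      (ModuleCat.of (ToeplitzAlgebra K) W) 2) := by
  refine subsingleton_of_forall_eq 0 fun e => ?_
  have hS := shortExact_shortComplexOfExact (LinearMap.exact_subtype_mkQ (IM K M)) (Submodule.injective_subtype _)
    (Submodule.mkQ_surjective _)
  have := (isXTorsion_IM K M).projective
  have := subsingleton_ext_of_projective (A := ToeplitzAlgebra K) (IM K M) W 1
  have := subsingleton_ext_two (M ⧸ IM K M) W (isGradedPair K) y_smul_bijective
  obtain ⟨e', rfl⟩ := Abelian.Ext.contravariant_sequence_exact₂ hS _ e (Subsingleton.elim _ _)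
  rw [Subsingleton.elim e' 0, Abelian.Ext.comp_zero]

variable [IsNoetherian (ToeplitzAlgebra K) M] [IsArtinian (ToeplitzAlgebra K) M]
  [IsNoetherian (ToeplitzAlgebra K) N] [IsArtinian (ToeplitzAlgebra K) N]

variable (K M) in
theorem finiteDimensional_quotient_IM : FiniteDimensional K (M ⧸ IM K M) :=
  finiteDimensional_of_isFiniteLength
    (isFiniteLength_iff_isNoetherian_isArtinian.mpr ⟨inferInstance, inferInstance⟩)

theorem finiteDimensional_hom_of_finiteDimensional {F : Type u} [AddCommGroup F] [Module K F]
    [Module (ToeplitzAlgebra K) F] [FiniteDimensional K F] {W : Type u} [AddCommGroup W]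
    [Module K W] [Module (ToeplitzAlgebra K) W] [IsScalarTower K (ToeplitzAlgebra K) F]
    [IsScalarTower K (ToeplitzAlgebra K) W] [FiniteDimensional K W] :
    FiniteDimensional K (F →ₗ[ToeplitzAlgebra K] W) :=
  Module.Finite.of_injective (LinearMap.restrictScalarsₗ K (ToeplitzAlgebra K) F W K)
    (LinearMap.restrictScalars_injective K)

variable (N) in
/-- The covariant sequence for `I N ⊆ N` and a finite-dimensional module `F`, in which
`Hom(F, I N) = 0` and `Ext¹(F, I N)` has dimension `ℓ(I N) dim F`. -/
theorem finrank_ext_of_finiteDimensional (F : Type u) [AddCommGroup F] [Module K F]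
    [Module (ToeplitzAlgebra K) F] [IsScalarTower K (ToeplitzAlgebra K) F]
    [FiniteDimensional K F] :
    FiniteDimensional K (F →ₗ[ToeplitzAlgebra K] N) ∧
      FiniteDimensional K (Ext1 (ToeplitzAlgebra K) F N) ∧
      (Module.finrank K (Ext1 (ToeplitzAlgebra K) F N) : ℤ) =
        Module.finrank K (Ext1 (ToeplitzAlgebra K) F (N ⧸ IM K N)) +
          len (ToeplitzAlgebra K) (IM K N) * Module.finrank K F +
          Module.finrank K (F →ₗ[ToeplitzAlgebra K] N) -
          Module.finrank K (F →ₗ[ToeplitzAlgebra K] (N ⧸ IM K N)) := by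
  have := finiteDimensional_quotient_IM K N
  have := (isXTorsion_IM K N).finiteDimensional_kerX
  obtain ⟨e⟩ := nonempty_ext1_equiv_of_isXTorsion (F := F) (isXTorsion_IM K N)
  have := Module.Finite.equiv e.symm
  have : Subsingleton (F →ₗ[ToeplitzAlgebra K] IM K N) :=
    subsingleton_of_forall_eq 0 (hom_eq_zero_of_killedByI (isXTorsion_IM K N))
  have : FiniteDimensional K (F →ₗ[ToeplitzAlgebra K] (N ⧸ IM K N)) :=
    finiteDimensional_hom_of_finiteDimensional
  have := finiteDimensional_ext1_of_killedByI (K := K) (V := F) (W := N ⧸ IM K N)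
  have := subsingleton_ext_two_toeplitz (K := K) (M := F) (W := IM K N)
  obtain ⟨h1, h2, h3⟩ := finrank_ext_covariant (K := K) (W := F) (LinearMap.exact_subtype_mkQ (IM K N))
    (Submodule.injective_subtype _) (Submodule.mkQ_surjective _)
  refine ⟨h1, h2, ?_⟩
  have h0 : Module.finrank K (F →ₗ[ToeplitzAlgebra K] IM K N) = 0 :=
    Module.finrank_zero_of_subsingleton
  rw [e.finrank_eq, Module.finrank_linearMap K K F (kerX K (IM K N)),
    ← len_eq_finrank_kerX (isXTorsion_IM K N), h0] at h3
  push_cast at h3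
  linarith

variable (M N) in
/-- The contravariant sequence for `I M ⊆ M`, in which `I M` is projective and `Hom(I M, N)` has
dimension `ℓ(I M) ℓ(I N)`. -/
theorem finrank_ext_eq_of_quotient :
    FiniteDimensional K (M →ₗ[ToeplitzAlgebra K] N) ∧
      FiniteDimensional K (Ext1 (ToeplitzAlgebra K) M N) ∧
      (Module.finrank K (Ext1 (ToeplitzAlgebra K) M N) : ℤ) =
        Module.finrank K (Ext1 (ToeplitzAlgebra K) (M ⧸ IM K M) N) +
          Module.finrank K (M →ₗ[ToeplitzAlgebra K] N) -
          Module.finrank K ((M ⧸ IM K M) →ₗ[ToeplitzAlgebra K] N) -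
          len (ToeplitzAlgebra K) (IM K M) * len (ToeplitzAlgebra K) (IM K N) := by
  have := finiteDimensional_quotient_IM K M
  obtain ⟨_, _, -⟩ := finrank_ext_of_finiteDimensional (K := K) N (M ⧸ IM K M)
  obtain ⟨_, h0⟩ := finrank_torsionHom (N := N) (isXTorsion_IM K M)
  have := (isXTorsion_IM K M).projective
  have : Subsingleton (Ext1 (ToeplitzAlgebra K) (IM K M) N) :=
    subsingleton_ext_of_projective (A := ToeplitzAlgebra K) (IM K M) N 0
  obtain ⟨h1, h2, h3⟩ := finrank_ext_contravariant (K := K) (W := N) (LinearMap.exact_subtype_mkQ (IM K M))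
    (Submodule.injective_subtype _) (Submodule.mkQ_surjective _)
  refine ⟨h1, h2, ?_⟩
  rw [h0, finrank_kerX_eq_len (N := N), ← len_eq_finrank_kerX (isXTorsion_IM K M)] at h3
  push_cast at h3
  linarith

variable (M N) in
theorem finrank_ext_eq_of_killedByI [KilledByI K N] :
    Module.finrank K (Ext1 (ToeplitzAlgebra K) M N) =
      Module.finrank K (Ext1 (ToeplitzAlgebra K) (M ⧸ IM K M) N) := by
  have h := (finrank_ext_eq_of_quotient (K := K) M N).2.2
  have hlen : len (ToeplitzAlgebra K) (IM K N) = 0 := by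
    rw [len, IM_eq_bot, Module.length_eq_zero, ENat.toNat_zero]
  rw [(quotientHomEquiv M N).finrank_eq, hlen] at h
  push_cast at h
  lia

variable (M N) in
/-- The covariant sequence for `I N ⊆ N`, in which `Hom(M, I N)` has dimension `d(M) ℓ(I N)`. -/
theorem finrank_ext_eq_of_target :
    (Module.finrank K (Ext1 (ToeplitzAlgebra K) M N) : ℤ) =
      Module.finrank K (Ext1 (ToeplitzAlgebra K) (M ⧸ IM K M) (N ⧸ IM K N)) +
        Module.finrank K (Ext1 (ToeplitzAlgebra K) M (IM K N)) +
        Module.finrank K (M →ₗ[ToeplitzAlgebra K] N) -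
        Module.finrank K ((M ⧸ IM K M) →ₗ[ToeplitzAlgebra K] (N ⧸ IM K N)) -
        d K M * len (ToeplitzAlgebra K) (IM K N) := by
  obtain ⟨_, _, -⟩ := finrank_ext_eq_of_quotient (K := K) M (IM K N)
  obtain ⟨_, _, -⟩ := finrank_ext_eq_of_quotient (K := K) M (N ⧸ IM K N)
  have := subsingleton_ext_two_toeplitz (K := K) (M := M) (W := IM K N)
  have := (isXTorsion_IM K N).finiteDimensional_kerX
  obtain ⟨-, -, h⟩ := finrank_ext_covariant (K := K) (W := M) (LinearMap.exact_subtype_mkQ (IM K N))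
    (Submodule.injective_subtype _) (Submodule.mkQ_surjective _)
  rw [finrank_hom_of_isXTorsion (isXTorsion_IM K N), ← len_eq_finrank_kerX (isXTorsion_IM K N),
    ← (quotientHomEquiv M (N ⧸ IM K N)).finrank_eq,
    finrank_ext_eq_of_killedByI M (N ⧸ IM K N)] at h
  push_cast at h
  linarith

end FiniteLength

end ToeplitzAlgebra
end

open ToeplitzAlgebra in
theorem corollary5 (K : Type u) [Field K] (M N F : Type u)
    [AddCommGroup M] [Module K M] [Module (ToeplitzAlgebra K) M]
    [IsScalarTower K (ToeplitzAlgebra K) M]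
    [AddCommGroup N] [Module K N] [Module (ToeplitzAlgebra K) N]
    [IsScalarTower K (ToeplitzAlgebra K) N]
    [AddCommGroup F] [Module K F] [Module (ToeplitzAlgebra K) F]
    [IsScalarTower K (ToeplitzAlgebra K) F]
    (hM : IsFiniteLength (ToeplitzAlgebra K) M) (hN : IsFiniteLength (ToeplitzAlgebra K) N)
    [FiniteDimensional K F] :
    -- all the numbers that occur are finite and well defined
    (FiniteDimensional K (M ⧸ IM K M) ∧ FiniteDimensional K (N ⧸ IM K N) ∧
      FiniteDimensional K (lf K N) ∧
      IsFiniteLength (ToeplitzAlgebra K) (IM K M) ∧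
      IsFiniteLength (ToeplitzAlgebra K) (IM K N) ∧
      IsGreatest (summandMultiplicities K M) (d K M) ∧
      FiniteDimensional K (M →ₗ[ToeplitzAlgebra K] N) ∧
      FiniteDimensional K (Ext1 (ToeplitzAlgebra K) F N) ∧
      FiniteDimensional K (Ext1 (ToeplitzAlgebra K) M N) ∧
      FiniteDimensional K (Ext1 (ToeplitzAlgebra K) M F) ∧
      FiniteDimensional K (Ext1 (ToeplitzAlgebra K) (M ⧸ IM K M) N) ∧
      FiniteDimensional K (Ext1 (ToeplitzAlgebra K) M (IM K N)) ∧
      FiniteDimensional K (Ext1 K[T;T⁻¹] F (N ⧸ IM K N)) ∧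
      FiniteDimensional K (Ext1 K[T;T⁻¹] (M ⧸ IM K M) F) ∧
      FiniteDimensional K (Ext1 K[T;T⁻¹] (M ⧸ IM K M) (N ⧸ IM K N)) ∧
      FiniteDimensional K (F →ₗ[K[T;T⁻¹]] lf K N) ∧
      FiniteDimensional K (F →ₗ[K[T;T⁻¹]] (N ⧸ IM K N)) ∧
      FiniteDimensional K ((M ⧸ IM K M) →ₗ[K[T;T⁻¹]] lf K N) ∧
      FiniteDimensional K ((M ⧸ IM K M) →ₗ[K[T;T⁻¹]] (N ⧸ IM K N))) ∧
    -- (i)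
    ((Module.finrank K (Ext1 (ToeplitzAlgebra K) F N) : ℤ) =
      Module.finrank K (Ext1 K[T;T⁻¹] F (N ⧸ IM K N))
        + len (ToeplitzAlgebra K) (IM K N) * Module.finrank K F
        + Module.finrank K (F →ₗ[K[T;T⁻¹]] lf K N)
        - Module.finrank K (F →ₗ[K[T;T⁻¹]] (N ⧸ IM K N))) ∧
    -- (ii)
    ((Module.finrank K (Ext1 (ToeplitzAlgebra K) M N) : ℤ) =
      Module.finrank K (Ext1 (ToeplitzAlgebra K) (M ⧸ IM K M) N)
        + Module.finrank K (M →ₗ[ToeplitzAlgebra K] N)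
        - Module.finrank K ((M ⧸ IM K M) →ₗ[K[T;T⁻¹]] lf K N)
        - len (ToeplitzAlgebra K) (IM K M) * len (ToeplitzAlgebra K) (IM K N)) ∧
    -- (iii)
    (Module.finrank K (Ext1 (ToeplitzAlgebra K) M F) =
      Module.finrank K (Ext1 K[T;T⁻¹] (M ⧸ IM K M) F)) ∧
    -- (iv)
    ((Module.finrank K (Ext1 (ToeplitzAlgebra K) M N) : ℤ) =
      Module.finrank K (Ext1 K[T;T⁻¹] (M ⧸ IM K M) (N ⧸ IM K N))
        + Module.finrank K (Ext1 (ToeplitzAlgebra K) M (IM K N))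
        + Module.finrank K (M →ₗ[ToeplitzAlgebra K] N)
        - Module.finrank K ((M ⧸ IM K M) →ₗ[K[T;T⁻¹]] (N ⧸ IM K N))
        - d K M * len (ToeplitzAlgebra K) (IM K N)) := by
  obtain ⟨_, _⟩ := isFiniteLength_iff_isNoetherian_isArtinian.mp hM
  obtain ⟨_, _⟩ := isFiniteLength_iff_isNoetherian_isArtinian.mp hN
  have : IsNoetherian (ToeplitzAlgebra K) F := isNoetherian_of_tower K inferInstance
  have : IsArtinian (ToeplitzAlgebra K) F := isArtinian_of_tower K inferInstance
  have hMQ := finiteDimensional_quotient_IM K M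
  have hNQ := finiteDimensional_quotient_IM K N
  have hlf := finiteDimensional_lf K N
  obtain ⟨eFN⟩ := nonempty_ext1_equiv_laurent (K := K) (V := F) (W := N ⧸ IM K N)
  obtain ⟨eMF⟩ := nonempty_ext1_equiv_laurent (K := K) (V := M ⧸ IM K M) (W := F)
  obtain ⟨eMN⟩ := nonempty_ext1_equiv_laurent (K := K) (V := M ⧸ IM K M) (W := N ⧸ IM K N)
  have := finiteDimensional_ext1_of_killedByI (K := K) (V := F) (W := N ⧸ IM K N)
  have := finiteDimensional_ext1_of_killedByI (K := K) (V := M ⧸ IM K M) (W := F)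
  have := finiteDimensional_ext1_of_killedByI (K := K) (V := M ⧸ IM K M) (W := N ⧸ IM K N)
  have hFN : FiniteDimensional K (F →ₗ[ToeplitzAlgebra K] (N ⧸ IM K N)) :=
    finiteDimensional_hom_of_finiteDimensional
  have hMN : FiniteDimensional K ((M ⧸ IM K M) →ₗ[ToeplitzAlgebra K] (N ⧸ IM K N)) :=
    finiteDimensional_hom_of_finiteDimensional
  obtain ⟨hF, hExtF, h1⟩ := finrank_ext_of_finiteDimensional (K := K) N F
  obtain ⟨hQ, hExtQ, -⟩ := finrank_ext_of_finiteDimensional (K := K) N (M ⧸ IM K M)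
  obtain ⟨hHom, hExt, h2⟩ := finrank_ext_eq_of_quotient (K := K) M N
  obtain ⟨-, hExtMF, -⟩ := finrank_ext_eq_of_quotient (K := K) M F
  obtain ⟨-, hExtMI, -⟩ := finrank_ext_eq_of_quotient (K := K) M (IM K N)
  have h3 := finrank_ext_eq_of_killedByI (K := K) M F
  have h4 := finrank_ext_eq_of_target (K := K) M N
  let lF := (lfHomEquiv K N F).symm ≪≫ₗ laurentHomEquiv
  let lM := (lfHomEquiv K N (M ⧸ IM K M)).symm ≪≫ₗ laurentHomEquiv
  let qF := laurentHomEquiv (K := K) (V := F) (W := N ⧸ IM K N)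
  let qM := laurentHomEquiv (K := K) (V := M ⧸ IM K M) (W := N ⧸ IM K N)
  refine ⟨⟨hMQ, hNQ, hlf,
    isFiniteLength_iff_isNoetherian_isArtinian.mpr ⟨inferInstance, inferInstance⟩,
    isFiniteLength_iff_isNoetherian_isArtinian.mpr ⟨inferInstance, inferInstance⟩,
    d_eq_finrank_hom (K := K) (M := M) ▸ isGreatest_summandMultiplicities,
    hHom, hExtF, hExt, hExtMF, hExtQ, hExtMI,
    Module.Finite.equiv eFN, Module.Finite.equiv eMF, Module.Finite.equiv eMN,
    Module.Finite.equiv lF, Module.Finite.equiv qF, Module.Finite.equiv lM,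
    Module.Finite.equiv qM⟩, ?_, ?_, ?_, ?_⟩
  · rw [← eFN.finrank_eq, ← lF.finrank_eq, ← qF.finrank_eq]
    exact h1
  · rw [← lM.finrank_eq]
    exact h2
  · rw [← eMF.finrank_eq]
    exact h3
  · rw [← eMN.finrank_eq, ← qM.finrank_eq]
    exact h4
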